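/- Let $d\in\{2,3\}$ and let $\Omega\subset\mathbb R^d$ be a (nonempty) bounded convex domain with $C^1$ boundary and outer unit normal $n$. Let $\Omega_1,\dots,\Omega_N\subset\Omega$ be pairwise disjoint open connected nonempty sets with $\overline\Omega=\bigcup_j\overline{\Omega_j}$, put $\Omega_0=\bigcup_j\Omega_j$, and assume that the number of $t\ge 0$ with $x-t\xi\in\partial\Omega_0$ is finite and bounded uniformly in $(x,\xi)\in\Omega\times S^{d-1}$. Let $\mu_t,\mu_s:\mathbb R^d\to[0,\infty)$ be bounded, continuous on $\Omega_0$, zero outside $\Omega_0$, with $\mu_s\le\mu_t$ on $\Omega_0$; let $p:\mathbb R^d\times S^{d-1}\times S^{d-1}\to[0,\infty)$ be bounded, continuous on $\Omega_0\times S^{d-1}\times S^{d-1}$, zero for $x\notin\Omega_0$, with $\int_{S^{d-1}}p(x,\xi,\xi')\,d\sigma_{\xi'}=1$ for $(x,\xi)\in\Omega_0\times S^{d-1}$, where $\sigma$ is the surface measure. Put $\Gamma_\pm=\{(x,\xi)\in\partial\Omega\times S^{d-1}:\pm n(x)\cdot\xi>0\}$, $D=(\Omega\times S^{d-1})\cup\Gamma_-$,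 $\overline D=D\cup\Gamma_+$, $\tau_-(x,\xi)=\inf\{t>0:x-t\xi\notin\Omega\}$ and $P(x,\xi)=x-\tau_-(x,\xi)\xi$. For a function $f_0$ on $\Gamma_-$, a bounded function $f$ on $D$ is called a solution with incoming data $f_0$ if: (i) $\xi\cdot\nabla_xf(x,\xi):=\frac{d}{dt}f(x+t\xi,\xi)|_{t=0}$ exists at every $(x,\xi)\in\Omega_0\times S^{d-1}$; (ii) for all $(x,\xi)\in\Omega_0\times S^{d-1}$ the integral below exists and $$\xi\cdot\nabla_xf(x,\xi)+\mu_t(x)f(x,\xi)=\mu_s(x)\int_{S^{d-1}}p(x,\xi,\xi')f(x,\xi')\,d\sigma_{\xi'},$$ and $f=f_0$ on $\Gamma_-$; (iii) for every $(x,\xi)\in D$, $t\mapsto f(x+t\xi,\xi)$ is continuous on $\{t:(x+t\xi,\xi)\in D\}$; (iv) for every $(x,\xi)\in\Omega_0\times S^{d-1}$, $\xi\cdot\nabla_xf(\cdot,\xi)$ is continuous along the part of the line $x+\mathbb R\xi$ that lies in $\Omega_0$. Let $\gamma\subset\partial\Omega$ be a set of two points if $d=2$, a simple closed curve if $d=3$,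 and let $A$, $B$ be the two connected components into which it splits $\partial\Omega$: $A\ne B$ are connected components of $\partial\Omega\setminus\gamma$ and $\partial\Omega=A\cup B\cup\gamma$. Let $I\in\mathbb R$, let $f_0(x,\xi)=I$ if $(x,\xi)\in\Gamma_-$, $x\in A\cup\gamma$, and $f_0(x,\xi)=0$ if $(x,\xi)\in\Gamma_-$, $x\in B$, and let $f$ be a solution with incoming data $f_0$. Then for every $(x,\xi)\in\Gamma_+$ the limit $\lim_{t\downarrow0}f(x-t\xi,\xi)$ exists; let $\overline f:\overline D\to\mathbb R$ be the extension of $f$ by these limits. For every $(x^*,\xi^*)\in\overline D$ at which $\overline f$ is discontinuous (as a function on $\overline D$), $x^*$ is an accumulation point of each of the sets $\{x:(x,\xi^*)\in\overline D,\ P(x,\xi^*)\in A\cup\gamma\}$ and $\{x:(x,\xi^*)\in\overline D,\ P(x,\xi^*)\in B\}$, the jump $$[\overline f](x^*,\xi^*):=\lim_{\substack{x\to x^*\\P(x,\xi^*)\in A\cup\gamma}}\overline f(x,\xi^*)-\lim_{\substack{x\to x^*\\P(x,\xi^*)\in B}}\overline f(x,\xi^*)$$ exists (both limits exist), and $$[\overline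 f](x^*,\xi^*)=I\exp\Bigl(-\int_0^{\tau_-(x^*,\xi^*)}\mu_t(x^*-r\xi^*)\,dr\Bigr).$$ In particular, if moreover $(x^*,\xi^*)\in\Gamma_+$, then $$(X\mu_t)(x^*,\xi^*):=\int_{\mathbb R}\mu_t(x^*-r\xi^*)\,dr=\int_0^{\tau_-(x^*,\xi^*)}\mu_t(x^*-r\xi^*)\,dr=-\log\bigl([\overline f](x^*,\xi^*)/I\bigr).$$ -/

import Mathlib

open Set Filter Topology MeasureTheory

noncomputable section

namespace Transport

/-- Euclidean space `ℝ^d`. -/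
abbrev E (d : ℕ) : Type := EuclideanSpace ℝ (Fin d)

/-- The unit sphere `S^{d-1}` of directions. -/
abbrev S (d : ℕ) : Type := Metric.sphere (0 : E d) 1

/-- The surface (Lebesgue) measure on the unit sphere, of total mass `d * vol(unit ball)`. -/
def sphereMeasure (d : ℕ) : Measure (S d) := (volume : Measure (E d)).toSphere

variable {d : ℕ}

/-- `φ` is a `C¹` function near the boundary point `x`, with non-vanishing gradient at `x`,
such that `Ω` is the set `{φ < 0}` near `x`. -/
def IsLocalDefiningFunction (Ω : Set (E d)) (x : E d) (φ : E d → ℝ) : Prop :=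
  ∃ U : Set (E d), IsOpen U ∧ x ∈ U ∧ ContDiffOn ℝ 1 φ U ∧ gradient φ x ≠ 0 ∧
    Ω ∩ U = {y ∈ U | φ y < 0}

/-- The boundary of the open set `Ω` is of class `C¹`, and `Ω` lies locally on one side of it. -/
def HasC1Boundary (Ω : Set (E d)) : Prop :=
  ∀ x ∈ frontier Ω, ∃ φ : E d → ℝ, IsLocalDefiningFunction Ω x φ

open Classical in
/-- The outer unit normal `n(x) = ∇φ(x) / |∇φ(x)|` at a `C¹` boundary point; it does not depend on
the local defining function `φ`. -/
def outerNormal (Ω : Set (E d)) (x : E d) : E d :=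
  if h : ∃ φ : E d → ℝ, IsLocalDefiningFunction Ω x φ then
    ‖gradient h.choose x‖⁻¹ • gradient h.choose x
  else 0

/-- The incoming boundary `Γ₋`. -/
def GammaMinus (Ω : Set (E d)) : Set (E d × S d) :=
  {q | q.1 ∈ frontier Ω ∧ inner ℝ (outerNormal Ω q.1) (q.2 : E d) < 0}

/-- The outgoing boundary `Γ₊`. -/
def GammaPlus (Ω : Set (E d)) : Set (E d × S d) :=
  {q | q.1 ∈ frontier Ω ∧ 0 < inner ℝ (outerNormal Ω q.1) (q.2 : E d)}

/-- `D = (Ω × S^{d-1}) ∪ Γ₋`. -/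
def phaseD (Ω : Set (E d)) : Set (E d × S d) :=
  {q | q.1 ∈ Ω} ∪ GammaMinus Ω

/-- `D̄ = D ∪ Γ₊`. -/
def phaseDbar (Ω : Set (E d)) : Set (E d × S d) :=
  phaseD Ω ∪ GammaPlus Ω

/-- The backward travel time `τ₋(x, ξ) = inf {t > 0 | x - t ξ ∉ Ω}`. -/
def tauMinus (Ω : Set (E d)) (q : E d × S d) : ℝ :=
  sInf {t : ℝ | 0 < t ∧ q.1 - t • (q.2 : E d) ∉ Ω}

/-- The backward exit point `P(x, ξ) = x - τ₋(x, ξ) ξ`. -/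
def exitPoint (Ω : Set (E d)) (q : E d × S d) : E d :=
  q.1 - tauMinus Ω q • (q.2 : E d)

/-- The geometric setting: `Ω` is a bounded convex domain with `C¹` boundary, whose closure is the
union of the closures of finitely many pairwise disjoint subdomains `Ωs j`, and the union `Ω₀` of
the subdomains satisfies the generalized convexity condition: the number of points at which a half
line `{x - t ξ | t ≥ 0}` with `x ∈ Ω` meets `∂Ω₀` is bounded, uniformly in `(x, ξ)`. -/
structure IsAdmissibleDomain (Ω : Set (E d)) {N : ℕ} (Ωs : Fin N → Set (E d)) : Prop where
  isOpen : IsOpen Ω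
  nonempty : Ω.Nonempty
  bounded : Bornology.IsBounded Ω
  convex : Convex ℝ Ω
  c1 : HasC1Boundary Ω
  sub_isOpen : ∀ j, IsOpen (Ωs j)
  sub_connected : ∀ j, IsConnected (Ωs j)
  sub_subset : ∀ j, Ωs j ⊆ Ω
  sub_disjoint : Pairwise fun i j => Disjoint (Ωs i) (Ωs j)
  closure_eq : closure Ω = ⋃ j, closure (Ωs j)
  generalized_convexity : ∃ L : ℕ, ∀ x ∈ Ω, ∀ ξ : S d,
    {t : ℝ | 0 ≤ t ∧ x - t • (ξ : E d) ∈ frontier (⋃ j, Ωs j)}.encard ≤ L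

/-- The standing assumptions on the attenuation coefficient `μt`, the scattering coefficient `μs`
and the scattering phase function `p`, relative to the open set `Ω₀`. -/
structure IsAdmissibleMedium (Ω₀ : Set (E d)) (μt μs : E d → ℝ) (p : E d → S d → S d → ℝ) :
    Prop where
  mut_nonneg : ∀ x, 0 ≤ μt x
  mus_nonneg : ∀ x, 0 ≤ μs x
  mut_bounded : ∃ C, ∀ x, μt x ≤ C
  mus_bounded : ∃ C, ∀ x, μs x ≤ C
  mus_le_mut : ∀ x ∈ Ω₀, μs x ≤ μt x
  mut_continuousOn : ContinuousOn μt Ω₀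
  mus_continuousOn : ContinuousOn μs Ω₀
  mut_zero : ∀ x ∉ Ω₀, μt x = 0
  mus_zero : ∀ x ∉ Ω₀, μs x = 0
  p_nonneg : ∀ x ξ ξ', 0 ≤ p x ξ ξ'
  p_bounded : ∃ C, ∀ x ξ ξ', p x ξ ξ' ≤ C
  p_continuousOn : ContinuousOn (fun z : E d × S d × S d => p z.1 z.2.1 z.2.2) (Ω₀ ×ˢ univ)
  p_zero : ∀ x ∉ Ω₀, ∀ ξ ξ', p x ξ ξ' = 0
  p_normalized : ∀ x ∈ Ω₀, ∀ ξ, ∫ ξ', p x ξ ξ' ∂(sphereMeasure d) = 1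

/-- The directional derivative `ξ · ∇ₓ f(x, ξ) = d/dt f(x + t ξ, ξ) |_{t = 0}`. -/
def dirDeriv (f : E d × S d → ℝ) (x : E d) (ξ : S d) : ℝ :=
  deriv (fun t : ℝ => f (x + t • (ξ : E d), ξ)) 0

/-- `f` (of which only the values on `D` matter) is a solution of the boundary value problem
`ξ · ∇ₓ f + μt f = μs ∫ p(x, ξ, ξ') f(x, ξ') dσ(ξ')` in `Ω₀ × S^{d-1}`, `f = f₀` on `Γ₋`.
The scattering integral in the equation is required to exist. -/
structure IsSolution (Ω Ω₀ : Set (E d)) (μt μs : E d → ℝ) (p : E d → S d → S d → ℝ)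
    (f₀ f : E d × S d → ℝ) : Prop where
  bounded : ∃ C, ∀ q ∈ phaseD Ω, |f q| ≤ C
  differentiable : ∀ x ∈ Ω₀, ∀ ξ : S d,
    DifferentiableAt ℝ (fun t : ℝ => f (x + t • (ξ : E d), ξ)) 0
  scattering_integrable : ∀ x ∈ Ω₀, ∀ ξ : S d,
    Integrable (fun ξ' : S d => p x ξ ξ' * f (x, ξ')) (sphereMeasure d)
  equation : ∀ x ∈ Ω₀, ∀ ξ : S d,
    dirDeriv f x ξ + μt x * f (x, ξ) = μs x * ∫ ξ', p x ξ ξ' * f (x, ξ') ∂(sphereMeasure d)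
  boundary : ∀ q ∈ GammaMinus Ω, f q = f₀ q
  continuous_along : ∀ q ∈ phaseD Ω,
    ContinuousOn (fun t : ℝ => f (q.1 + t • (q.2 : E d), q.2))
      {t : ℝ | (q.1 + t • (q.2 : E d), q.2) ∈ phaseD Ω}
  deriv_continuous_along : ∀ x ∈ Ω₀, ∀ ξ : S d,
    ContinuousOn (fun t : ℝ => dirDeriv f (x - t • (ξ : E d)) ξ)
      {t : ℝ | x - t • (ξ : E d) ∈ Ω₀}

open Classical in
/-- The extension `f̄` of `f` to `D̄`: on `Γ₊` it is the limit of `f(x - t ξ, ξ)` as `t ↓ 0`.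
(Outside `D̄` the value is irrelevant.) -/
def extension (Ω : Set (E d)) (f : E d × S d → ℝ) (q : E d × S d) : ℝ :=
  if q ∈ phaseD Ω then f q
  else if q ∈ GammaPlus Ω then
    limUnder (𝓝[>] (0 : ℝ)) (fun t : ℝ => f (q.1 - t • (q.2 : E d), q.2))
  else 0

/-- The discontinuity points of a function on `D̄`. -/
def discSet (Ω : Set (E d)) (g : E d × S d → ℝ) : Set (E d × S d) :=
  {q ∈ phaseDbar Ω | ¬ ContinuousWithinAt g (phaseDbar Ω) q}

/-- The admissible sets `γ ⊆ ∂Ω`: two points if `d = 2`, a simple closed curve if `d = 3`. -/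
def IsDividing (Ω γ : Set (E d)) : Prop :=
  γ ⊆ frontier Ω ∧
    ((d = 2 ∧ γ.ncard = 2) ∨
     (d = 3 ∧ ∃ c : Circle → E d, Continuous c ∧ Function.Injective c ∧ range c = γ))

/-- `A` and `B` are the two connected components into which `γ` splits `∂Ω`. -/
def SplitsInto (Ω γ A B : Set (E d)) : Prop :=
  (∃ a ∈ frontier Ω \ γ, A = connectedComponentIn (frontier Ω \ γ) a) ∧
  (∃ b ∈ frontier Ω \ γ, B = connectedComponentIn (frontier Ω \ γ) b) ∧
  Disjoint A B ∧ A ∪ B = frontier Ω \ γ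

/-- The boundary data equal to `I` over `A ∪ γ` and to `0` over `B`. -/
def stepData (A γ : Set (E d)) (I : ℝ) (q : E d × S d) : ℝ :=
  (A ∪ γ).indicator (fun _ => I) q.1

/-- The points `x` of the `ξ`-section of `D̄` whose backward exit point lies in `K ⊆ ∂Ω`. -/
def sideSet (Ω : Set (E d)) (ξ : S d) (K : Set (E d)) : Set (E d) :=
  {x | (x, ξ) ∈ phaseDbar Ω ∧ exitPoint Ω (x, ξ) ∈ K}

/-- The jump `[g](x̄, ξ̄)` exists and equals `J`: the limits of `g(x, ξ̄)` as `x → x̄` with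
`P(x, ξ̄) ∈ A ∪ γ`, and with `P(x, ξ̄) ∈ B`, are both meaningful (`x̄` is an accumulation point of
both sets), both exist, and their difference is `J`. -/
def HasJump (Ω A B γ : Set (E d)) (g : E d × S d → ℝ) (q : E d × S d) (J : ℝ) : Prop :=
  AccPt q.1 (𝓟 (sideSet Ω q.2 (A ∪ γ))) ∧ AccPt q.1 (𝓟 (sideSet Ω q.2 B)) ∧
  ∃ a b : ℝ,
    Tendsto (fun x => g (x, q.2)) (𝓝[sideSet Ω q.2 (A ∪ γ)] q.1) (𝓝 a) ∧
    Tendsto (fun x => g (x, q.2)) (𝓝[sideSet Ω q.2 B] q.1) (𝓝 b) ∧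
    J = a - b

/-- The X-ray transform `(X μ)(x, ξ) = ∫_ℝ μ(x - r ξ) dr`. -/
def xRay (μ : E d → ℝ) (q : E d × S d) : ℝ :=
  ∫ r : ℝ, μ (q.1 - r • (q.2 : E d))

end Transport

end

noncomputable section

namespace Transport

variable {d : ℕ} {Ω : Set (E d)}

/-! Along a characteristic the transport equation is a linear ODE. With G the scattering term, an
integrating factor gives f(x, ξ) = f₀(P(x, ξ), ξ) exp(-∫₀^τ μt) + ∫₀^τ exp(-∫₀^s μt) G(x - sξ, ξ) ds
(`eq_ballistic_add_collided_tauMinus`). Since μt and G vanish outside Ω, τ may be replaced by a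
constant R exceeding the diameter. A line through Ω meets the interfaces finitely often, so if G is
continuous on Ω₀ × S, dominated convergence makes the exponential u and the collided integral v
continuous at every point of D̄. Hence the extension is I · 1_{A ∪ γ}(P) · u + v
(`exists_extension_decomposition`): only the indicator can jump, and the jump is I · u.

The work lies in the regularity of G, because f is assumed continuous only along lines in its own
direction. Uniform continuity of p on compacts makes G continuous in the direction, locally
uniformly in x; the equation itself makes G(·, η) continuous along η. Approximating ξ by a basis of
nearby directions then gives measurability of G (`measurable_scatter`).

For joint continuity the integral formula is inserted into G (`continuousOn_scatter`). The collided
part becomes, in polar coordinates, a weakly singular integral over y in which G is evaluated at the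
fixed point y, so continuity in the direction suffices (`continuousAt_integral_collided`). The
ballistic part contains the discontinuous function 1_{A ∪ γ}(P(x, ·)), and γ may have positive
surface measure, so pointwise convergence almost everywhere is not available. Instead the
distributions of exit points seen from nearby points are dominated by a multiple of the one seen
from x₀ (`exists_map_exitPoint_le`), which gives convergence in L¹.

Finally, a discontinuity produces exit points of both kinds near q in phase space, and
`accPt_sideSet` moves them into the section with fixed direction. -/

theorem norm_dir (ξ : S d) : ‖(ξ : E d)‖ = 1 := by
  simp

/-! ### The incoming and outgoing boundary of a convex domain -/

theorem IsLocalDefiningFunction.tendsto_slope {x : E d} {φ : E d → ℝ}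
    (h : IsLocalDefiningFunction Ω x φ) (v : E d) :
    Tendsto (fun t : ℝ => t⁻¹ * (φ (x + t • v) - φ x)) (𝓝[>] 0)
      (𝓝 (inner ℝ (gradient φ x) v)) := by
  obtain ⟨U, hU, hxU, hφ, -, -⟩ := h
  have h1 : DifferentiableAt ℝ φ x :=
    (hφ.contDiffAt (hU.mem_nhds hxU)).differentiableAt (by simp)
  have h2 : HasFDerivAt φ (InnerProductSpace.toDual ℝ (E d) (gradient φ x)) x :=
    h1.hasGradientAt.hasFDerivAt
  have h3 : HasDerivAt (fun t : ℝ => x + t • v) v 0 := by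
    simpa using ((hasDerivAt_id (0 : ℝ)).smul_const v).const_add x
  have h4 : HasDerivAt (fun t : ℝ => φ (x + t • v)) (inner ℝ (gradient φ x) v) 0 := by
    have h2' : HasFDerivAt φ (InnerProductSpace.toDual ℝ (E d) (gradient φ x))
        (x + (0 : ℝ) • v) := by simpa using h2
    exact h2'.comp_hasDerivAt (0 : ℝ) h3
  simpa [smul_eq_mul] using h4.tendsto_slope_zero_right

theorem IsLocalDefiningFunction.eventually_mem {x : E d} {φ : E d → ℝ}
    (h : IsLocalDefiningFunction Ω x φ) : ∀ᶠ y in 𝓝 x, (y ∈ Ω ↔ φ y < 0) := by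
  obtain ⟨U, hU, hxU, -, -, hΩU⟩ := h
  filter_upwards [hU.mem_nhds hxU] with y hy
  constructor
  · intro hyΩ
    have : y ∈ Ω ∩ U := ⟨hyΩ, hy⟩
    rw [hΩU] at this
    exact this.2
  · intro hyφ
    have : y ∈ {y ∈ U | φ y < 0} := ⟨hy, hyφ⟩
    rw [← hΩU] at this
    exact this.1

theorem tendsto_line (x v : E d) : Tendsto (fun t : ℝ => x + t • v) (𝓝[>] 0) (𝓝 x) := by
  have : Continuous (fun t : ℝ => x + t • v) := by fun_prop
  simpa using (this.tendsto 0).mono_left nhdsWithin_le_nhds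

theorem IsLocalDefiningFunction.eq_zero {x : E d} {φ : E d → ℝ} (hO : IsOpen Ω)
    (h : IsLocalDefiningFunction Ω x φ) (hx : x ∈ frontier Ω) : φ x = 0 := by
  have hxΩ : x ∉ Ω := by
    rw [hO.frontier_eq] at hx
    exact hx.2
  apply le_antisymm
  · have hcl : (𝓝[Ω] x).NeBot := mem_closure_iff_nhdsWithin_neBot.1 (frontier_subset_closure hx)
    have hcont : ContinuousAt φ x := by
      obtain ⟨U, hU, hxU, hφ, -, -⟩ := h
      exact (hφ.contDiffAt (hU.mem_nhds hxU)).continuousAt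
    refine le_of_tendsto (hcont.tendsto.mono_left (nhdsWithin_le_nhds (s := Ω))) ?_
    filter_upwards [self_mem_nhdsWithin, nhdsWithin_le_nhds h.eventually_mem] with y hy1 hy2
    exact (hy2.1 hy1).le
  · have := h.eventually_mem.self_of_nhds
    by_contra hlt
    exact hxΩ (this.2 (not_le.1 hlt))

/-- A segment from x into Ω stays in Ω by convexity, so φ decreases from 0 and its slope is at most
0. Strictness comes from openness of Ω. -/
theorem IsLocalDefiningFunction.inner_neg {x : E d} {φ : E d → ℝ} (hO : IsOpen Ω)
    (hc : Convex ℝ Ω) (h : IsLocalDefiningFunction Ω x φ) (hx : x ∈ frontier Ω) {v : E d}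
    (hv : ∃ t : ℝ, 0 < t ∧ x + t • v ∈ Ω) : inner ℝ (gradient φ x) v < 0 := by
  have key : ∀ w : E d, x + w ∈ Ω → inner ℝ (gradient φ x) w ≤ 0 := by
    intro w hw
    refine le_of_tendsto (h.tendsto_slope w) ?_
    have hmem : ∀ᶠ t : ℝ in 𝓝[>] 0, t < 1 := nhdsWithin_le_nhds (Iio_mem_nhds one_pos)
    filter_upwards [self_mem_nhdsWithin, (tendsto_line x w).eventually h.eventually_mem, hmem]
      with t ht1 ht2 ht3
    have ht1 : 0 < t := ht1
    have hin : x + t • w ∈ Ω := by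
      have := hc.combo_interior_closure_mem_interior (x := x + w) (y := x)
        (by rwa [hO.interior_eq]) (frontier_subset_closure hx) ht1 (b := 1 - t) (by linarith)
        (by ring)
      rw [hO.interior_eq] at this
      convert this using 1
      module
    have := ht2.1 hin
    rw [h.eq_zero hO hx]
    have : 0 < t⁻¹ := inv_pos.2 ht1
    nlinarith
  obtain ⟨t, ht, htv⟩ := hv
  have hg : gradient φ x ≠ 0 := by
    obtain ⟨U, -, -, -, hg, -⟩ := h
    exact hg
  -- Tilting the target point slightly towards the gradient keeps it in Ω and adds s‖∇φ‖² > 0 to the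
  -- inner product, so equality is impossible.
  have hev : ∀ᶠ s : ℝ in 𝓝[>] 0, (x + t • v) + s • gradient φ x ∈ Ω :=
    (tendsto_line _ _).eventually (hO.mem_nhds htv)
  obtain ⟨s, hs1, hs2⟩ := (hev.and self_mem_nhdsWithin).exists
  have hs2 : 0 < s := hs2
  have := key (t • v + s • gradient φ x) (by rwa [← add_assoc])
  rw [inner_add_right, inner_smul_right, inner_smul_right, real_inner_self_eq_norm_sq] at this
  have h2 : 0 < s * ‖gradient φ x‖ ^ 2 := by positivity
  by_contra hneg
  have : 0 ≤ t * inner ℝ (gradient φ x) v := mul_nonneg ht.le (not_lt.1 hneg)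
  linarith

theorem IsLocalDefiningFunction.exists_mem {x : E d} {φ : E d → ℝ} (hO : IsOpen Ω)
    (h : IsLocalDefiningFunction Ω x φ) (hx : x ∈ frontier Ω) {v : E d}
    (hv : inner ℝ (gradient φ x) v < 0) : ∃ t : ℝ, 0 < t ∧ x + t • v ∈ Ω := by
  have h1 := (h.tendsto_slope v).eventually (Iio_mem_nhds hv)
  obtain ⟨t, ⟨ht1, ht2⟩, ht3⟩ :=
    ((h1.and ((tendsto_line x v).eventually h.eventually_mem)).and self_mem_nhdsWithin).exists
  have ht3 : 0 < t := ht3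
  refine ⟨t, ht3, ht2.2 ?_⟩
  rw [h.eq_zero hO hx, sub_zero] at ht1
  have ht1 : t⁻¹ * φ (x + t • v) < 0 := ht1
  by_contra hneg
  have := mul_nonneg (inv_pos.2 ht3).le (not_lt.1 hneg)
  linarith

/-- This eliminates the normal and the chosen defining function: afterwards Γ₋ and Γ₊ are described
only by whether a ray enters Ω. -/
theorem outerNormal_neg_iff (hO : IsOpen Ω) (hc : Convex ℝ Ω) (h1 : HasC1Boundary Ω) {x : E d}
    (hx : x ∈ frontier Ω) (v : E d) :
    inner ℝ (outerNormal Ω x) v < 0 ↔ ∃ t : ℝ, 0 < t ∧ x + t • v ∈ Ω := by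
  have hex := h1 x hx
  have hφ := hex.choose_spec
  have hg : gradient hex.choose x ≠ 0 := by
    obtain ⟨U, -, -, -, hg, -⟩ := hφ
    exact hg
  have hpos : 0 < ‖gradient hex.choose x‖⁻¹ := inv_pos.2 (norm_pos_iff.2 hg)
  rw [outerNormal, dif_pos hex, inner_smul_left]
  simp only [conj_trivial]
  constructor
  · intro h
    refine hφ.exists_mem hO hx ?_
    by_contra hneg
    have := mul_nonneg hpos.le (not_lt.1 hneg)
    linarith
  · intro h
    have := hφ.inner_neg hO hc hx h
    exact mul_neg_of_pos_of_neg hpos this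

/-- The geometric properties of a bounded convex `C¹` domain. -/
structure IsConvexDomain (Ω : Set (E d)) : Prop where
  isOpen : IsOpen Ω
  bounded : Bornology.IsBounded Ω
  convex : Convex ℝ Ω
  c1 : HasC1Boundary Ω

theorem IsAdmissibleDomain.isConvexDomain {N : ℕ} {Ωs : Fin N → Set (E d)}
    (h : IsAdmissibleDomain Ω Ωs) : IsConvexDomain Ω :=
  ⟨h.isOpen, h.bounded, h.convex, h.c1⟩

theorem mem_GammaMinus_iff (h : IsConvexDomain Ω) {q : E d × S d} :
    q ∈ GammaMinus Ω ↔ q.1 ∈ frontier Ω ∧ ∃ t : ℝ, 0 < t ∧ q.1 + t • (q.2 : E d) ∈ Ω := by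
  refine and_congr_right fun hx => ?_
  exact outerNormal_neg_iff h.isOpen h.convex h.c1 hx _

theorem mem_GammaPlus_iff (h : IsConvexDomain Ω) {q : E d × S d} :
    q ∈ GammaPlus Ω ↔ q.1 ∈ frontier Ω ∧ ∃ t : ℝ, 0 < t ∧ q.1 - t • (q.2 : E d) ∈ Ω := by
  refine and_congr_right fun hx => ?_
  have := outerNormal_neg_iff h.isOpen h.convex h.c1 hx (-(q.2 : E d))
  simp only [inner_neg_right, neg_neg_iff_pos, smul_neg, ← sub_eq_add_neg] at this
  exact this

theorem mem_phaseD_iff (h : IsConvexDomain Ω) {q : E d × S d} :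
    q ∈ phaseD Ω ↔ q.1 ∈ closure Ω ∧ ∃ t : ℝ, 0 < t ∧ q.1 + t • (q.2 : E d) ∈ Ω := by
  constructor
  · rintro (hq | hq)
    · have hq : q.1 ∈ Ω := hq
      obtain ⟨t, ht1, ht2⟩ := (((tendsto_line q.1 (q.2 : E d)).eventually
        (h.isOpen.mem_nhds hq)).and self_mem_nhdsWithin).exists
      exact ⟨subset_closure hq, t, ht2, ht1⟩
    · rw [mem_GammaMinus_iff h] at hq
      exact ⟨frontier_subset_closure hq.1, hq.2⟩
  · rintro ⟨h1, h2⟩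
    by_cases hq : q.1 ∈ Ω
    · exact Or.inl hq
    · right
      rw [mem_GammaMinus_iff h, h.isOpen.frontier_eq]
      exact ⟨⟨h1, hq⟩, h2⟩

/-- At a boundary point the sign of t decides between Γ₋ and Γ₊; exactly the boundary pairs whose
line misses Ω are left out. -/
theorem mem_phaseDbar_iff (h : IsConvexDomain Ω) {q : E d × S d} :
    q ∈ phaseDbar Ω ↔ q.1 ∈ closure Ω ∧ ∃ t : ℝ, q.1 + t • (q.2 : E d) ∈ Ω := by
  constructor
  · rintro (hq | hq)
    · rw [mem_phaseD_iff h] at hq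
      obtain ⟨h1, t, -, h2⟩ := hq
      exact ⟨h1, t, h2⟩
    · rw [mem_GammaPlus_iff h] at hq
      obtain ⟨h1, t, -, h2⟩ := hq
      exact ⟨frontier_subset_closure h1, -t, by rwa [neg_smul, ← sub_eq_add_neg]⟩
  · rintro ⟨h1, t, ht⟩
    by_cases hq : q.1 ∈ Ω
    · exact Or.inl (Or.inl hq)
    have hf : q.1 ∈ frontier Ω := by
      rw [h.isOpen.frontier_eq]
      exact ⟨h1, hq⟩
    rcases lt_trichotomy t 0 with h0 | h0 | h0
    · right
      rw [mem_GammaPlus_iff h]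
      refine ⟨hf, -t, by linarith, ?_⟩
      rwa [neg_smul, sub_neg_eq_add]
    · subst h0
      simp at ht
      exact absurd ht hq
    · left
      rw [mem_phaseD_iff h]
      exact ⟨h1, t, h0, ht⟩

/-! ### The backward travel time -/

theorem IsConvexDomain.between (h : IsConvexDomain Ω) {x v : E d} {a b c : ℝ}
    (ha : x + a • v ∈ closure Ω) (hb : x + b • v ∈ Ω) (hac : a < c) (hcb : c ≤ b) :
    x + c • v ∈ Ω := by
  have hab : 0 < b - a := by linarith
  have := h.convex.combo_interior_closure_mem_interior (x := x + b • v) (y := x + a • v)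
    (by rwa [h.isOpen.interior_eq]) ha (a := (c - a) / (b - a)) (b := (b - c) / (b - a))
    (div_pos (by linarith) hab) (div_nonneg (by linarith) hab.le) (by field_simp; ring)
  rw [h.isOpen.interior_eq] at this
  convert this using 1
  match_scalars <;> field_simp <;> ring

theorem IsConvexDomain.between' (h : IsConvexDomain Ω) {x v : E d} {a b c : ℝ}
    (ha : x + a • v ∈ Ω) (hb : x + b • v ∈ closure Ω) (hac : a ≤ c) (hcb : c < b) :
    x + c • v ∈ Ω := by
  have := h.between (x := x) (v := -v) (a := -b) (b := -a) (c := -c) (by simpa using hb)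
    (by simpa using ha) (by linarith) (by linarith)
  simpa using this

theorem exists_diam_bound (hb : Bornology.IsBounded Ω) :
    ∃ R : ℝ, 0 < R ∧ ∀ x ∈ closure Ω, ∀ y ∈ closure Ω, dist x y < R := by
  obtain ⟨C, hC⟩ := Metric.isBounded_iff.1 hb.closure
  exact ⟨max C 0 + 1, by positivity, fun x hx y hy =>
    lt_of_le_of_lt ((hC hx hy).trans (le_max_left _ _)) (lt_add_one _)⟩

theorem tauMinus_nonneg (q : E d × S d) : 0 ≤ tauMinus Ω q :=
  Real.sInf_nonneg fun _ ht => ht.1.le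

/-- By convexity the positive times spent in Ω form an interval starting at 0, possibly empty, and
by openness it does not contain its right end. -/
theorem mem_iff_lt_tauMinus (h : IsConvexDomain Ω) {q : E d × S d} (hq : q.1 ∈ closure Ω)
    {t : ℝ} (ht : 0 < t) : q.1 - t • (q.2 : E d) ∈ Ω ↔ t < tauMinus Ω q := by
  constructor
  · intro hmem
    obtain ⟨R, hR, hd⟩ := exists_diam_bound h.bounded
    -- Boundedness enters here: the infimum of the empty set would be the default value 0.
    have hne : {t : ℝ | 0 < t ∧ q.1 - t • (q.2 : E d) ∉ Ω}.Nonempty := by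
      refine ⟨R, hR, fun hc => ?_⟩
      have := hd _ hq _ (subset_closure hc)
      rw [dist_eq_norm, sub_sub_cancel, norm_smul, norm_dir, mul_one, Real.norm_eq_abs,
        abs_of_pos hR] at this
      exact lt_irrefl _ this
    have hcont : Tendsto (fun s : ℝ => (q.1 - t • (q.2 : E d)) + s • (-(q.2 : E d))) (𝓝[>] 0)
        (𝓝 (q.1 - t • (q.2 : E d))) := tendsto_line _ _
    obtain ⟨s, hs1, hs2⟩ :=
      ((hcont.eventually (h.isOpen.mem_nhds hmem)).and self_mem_nhdsWithin).exists
    have hs2 : 0 < s := hs2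
    have hts : q.1 - (t + s) • (q.2 : E d) ∈ Ω := by
      have heq : q.1 - (t + s) • (q.2 : E d) =
        (q.1 - t • (q.2 : E d)) + s • (-(q.2 : E d)) := by module
      rwa [heq]
    have : t + s ≤ tauMinus Ω q := by
      refine le_csInf hne fun r hr => ?_
      by_contra hlt
      refine hr.2 ?_
      have := h.between (x := q.1) (v := -(q.2 : E d)) (a := 0) (b := t + s) (c := r)
        (by simpa using hq) (by simpa [sub_eq_add_neg] using hts) hr.1 (not_le.1 hlt).le
      simpa [sub_eq_add_neg] using this
    linarith
  · intro hlt
    by_contra hn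
    have : tauMinus Ω q ≤ t := csInf_le ⟨0, fun r hr => hr.1.le⟩ ⟨ht, hn⟩
    linarith

theorem exitPoint_not_mem (h : IsConvexDomain Ω) {q : E d × S d} (hq : q.1 ∈ closure Ω) :
    exitPoint Ω q ∉ Ω := by
  intro hc
  rcases (tauMinus_nonneg (Ω := Ω) q).eq_or_lt with h0 | h0
  · rw [exitPoint, ← h0, zero_smul, sub_zero] at hc
    have hev : ∀ᶠ t : ℝ in 𝓝[>] 0, q.1 + t • (-(q.2 : E d)) ∈ Ω :=
      (tendsto_line _ _).eventually (h.isOpen.mem_nhds hc)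
    obtain ⟨t, ht1, ht2⟩ := (hev.and self_mem_nhdsWithin).exists
    have ht2 : 0 < t := ht2
    rw [smul_neg, ← sub_eq_add_neg, mem_iff_lt_tauMinus h hq ht2] at ht1
    linarith
  · rw [exitPoint, mem_iff_lt_tauMinus h hq h0] at hc
    exact lt_irrefl _ hc

theorem exitPoint_mem_closure (h : IsConvexDomain Ω) {q : E d × S d} (hq : q.1 ∈ closure Ω) :
    exitPoint Ω q ∈ closure Ω := by
  rcases (tauMinus_nonneg (Ω := Ω) q).eq_or_lt with h0 | h0
  · rwa [exitPoint, ← h0, zero_smul, sub_zero]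
  · have hcont : Continuous fun t : ℝ => q.1 - t • (q.2 : E d) := by fun_prop
    refine mem_closure_of_tendsto (b := 𝓝[<] (tauMinus Ω q))
      ((hcont.tendsto (tauMinus Ω q)).mono_left nhdsWithin_le_nhds) ?_
    filter_upwards [self_mem_nhdsWithin, nhdsWithin_le_nhds (Ioi_mem_nhds h0)] with t ht1 ht2
    exact (mem_iff_lt_tauMinus h hq ht2).2 ht1

theorem exitPoint_mem_frontier (h : IsConvexDomain Ω) {q : E d × S d} (hq : q.1 ∈ closure Ω) :
    exitPoint Ω q ∈ frontier Ω := by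
  rw [h.isOpen.frontier_eq]
  exact ⟨exitPoint_mem_closure h hq, exitPoint_not_mem h hq⟩

theorem neg_tauMinus_lt (h : IsConvexDomain Ω) {q : E d × S d} (hq : q.1 ∈ closure Ω) {t : ℝ}
    (ht : q.1 + t • (q.2 : E d) ∈ Ω) : -tauMinus Ω q < t := by
  rcases lt_trichotomy t 0 with h0 | h0 | h0
  · have := (mem_iff_lt_tauMinus h hq (t := -t) (by linarith)).1 (by simpa using ht)
    linarith
  · subst h0
    have h1 := exitPoint_not_mem h hq
    have h2 := tauMinus_nonneg (Ω := Ω) q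
    rcases h2.eq_or_lt with h3 | h3
    · rw [exitPoint, ← h3] at h1
      simp at h1 ht
      exact absurd ht h1
    · linarith
  · linarith [tauMinus_nonneg (Ω := Ω) q]

theorem exitPoint_mem_GammaMinus (h : IsConvexDomain Ω) {q : E d × S d} (hq : q ∈ phaseDbar Ω) :
    (exitPoint Ω q, q.2) ∈ GammaMinus Ω := by
  obtain ⟨h1, t, ht⟩ := (mem_phaseDbar_iff h).1 hq
  rw [mem_GammaMinus_iff h]
  refine ⟨exitPoint_mem_frontier h h1, tauMinus Ω q + t, ?_, ?_⟩
  · linarith [neg_tauMinus_lt h h1 ht]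
  · convert ht using 1
    simp only [exitPoint]
    module

/-- A later return to the closure would put the exit point strictly between a closure point and a
point of Ω on the same line. This excludes sliding along the boundary and is what makes τ₋ upper
semicontinuous. -/
theorem not_mem_closure_of_tauMinus_lt (h : IsConvexDomain Ω) {q : E d × S d}
    (hq : q ∈ phaseDbar Ω) {a : ℝ} (ha : tauMinus Ω q < a) :
    q.1 - a • (q.2 : E d) ∉ closure Ω := by
  intro hc
  obtain ⟨h1, t, ht⟩ := (mem_phaseDbar_iff h).1 hq
  refine exitPoint_not_mem h h1 ?_
  have := h.between (x := q.1) (v := (q.2 : E d)) (a := -a) (b := t) (c := - tauMinus Ω q)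
    (by simpa [sub_eq_add_neg] using hc) ht (by linarith) (neg_tauMinus_lt h h1 ht).le
  simpa [sub_eq_add_neg, exitPoint] using this

/-- Lower bounds persist because Ω is open, upper bounds because the complement of its closure is
open. -/
theorem continuousOn_tauMinus (h : IsConvexDomain Ω) :
    ContinuousOn (tauMinus Ω) (phaseDbar Ω) := by
  intro q₀ hq₀
  have hline : ∀ a : ℝ, ContinuousAt (fun q : E d × S d => q.1 - a • (q.2 : E d)) q₀ :=
    fun a => by fun_prop
  refine tendsto_order.2 ⟨fun a ha => ?_, fun a ha => ?_⟩
  · rcases lt_or_ge a 0 with h0 | h0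
    · exact Eventually.of_forall fun q => h0.trans_le (tauMinus_nonneg q)
    · obtain ⟨t, ht1, ht2⟩ := exists_between ha
      have ht0 : 0 < t := h0.trans_lt ht1
      have hmem := (mem_iff_lt_tauMinus h ((mem_phaseDbar_iff h).1 hq₀).1 ht0).2 ht2
      filter_upwards [self_mem_nhdsWithin, nhdsWithin_le_nhds
        ((hline t).tendsto.eventually (h.isOpen.mem_nhds hmem))] with q hq1 hq2
      exact ht1.trans ((mem_iff_lt_tauMinus h ((mem_phaseDbar_iff h).1 hq1).1 ht0).1 hq2)
  · obtain ⟨t, ht1, ht2⟩ := exists_between ha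
    have ht0 : 0 < t := (tauMinus_nonneg q₀).trans_lt ht1
    have hmem := not_mem_closure_of_tauMinus_lt h hq₀ ht1
    filter_upwards [self_mem_nhdsWithin, nhdsWithin_le_nhds
      ((hline t).tendsto.eventually (isClosed_closure.isOpen_compl.mem_nhds hmem))] with q hq1 hq2
    by_contra hge
    exact hq2 (subset_closure ((mem_iff_lt_tauMinus h ((mem_phaseDbar_iff h).1 hq1).1 ht0).2
      (ht2.trans_le (not_lt.1 hge))))

theorem continuousOn_exitPoint (h : IsConvexDomain Ω) :
    ContinuousOn (exitPoint Ω) (phaseDbar Ω) :=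
  continuousOn_fst.sub ((continuousOn_tauMinus h).smul
    (continuous_subtype_val.comp_continuousOn continuousOn_snd))

theorem tauMinus_add (h : IsConvexDomain Ω) {q : E d × S d} (hq : q ∈ phaseDbar Ω) {s : ℝ}
    (hs : (q.1 + s • (q.2 : E d), q.2) ∈ phaseDbar Ω) :
    tauMinus Ω (q.1 + s • (q.2 : E d), q.2) = tauMinus Ω q + s := by
  -- One inequality suffices: the other is the same statement for the shifted point and -s.
  have key : ∀ (q : E d × S d) (s : ℝ), q ∈ phaseDbar Ω →
      (q.1 + s • (q.2 : E d), q.2) ∈ phaseDbar Ω →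
      tauMinus Ω (q.1 + s • (q.2 : E d), q.2) ≤ tauMinus Ω q + s := by
    intro q s hq hs
    by_contra hlt
    obtain ⟨t, ht1, ht2⟩ := exists_between (not_le.1 hlt)
    have hq' := not_mem_closure_of_tauMinus_lt h hq (a := t - s) (by linarith)
    have heq : q.1 - (t - s) • (q.2 : E d) = q.1 + s • (q.2 : E d) - t • (q.2 : E d) := by module
    rw [heq] at hq'
    have hcl := ((mem_phaseDbar_iff h).1 hs).1
    rcases lt_or_ge 0 t with h0 | h0
    · exact hq' (subset_closure ((mem_iff_lt_tauMinus h hcl h0).2 ht2))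
    · have hsum : 0 ≤ tauMinus Ω q + s := by
        obtain ⟨h1, r, hr⟩ := (mem_phaseDbar_iff h).1 hq
        by_contra hneg
        have : q.1 + s • (q.2 : E d) ∉ closure Ω := by
          have := not_mem_closure_of_tauMinus_lt h hq (a := -s) (by linarith)
          simpa using this
        exact this hcl
      linarith
  refine le_antisymm (key q s hq hs) ?_
  have := key (q.1 + s • (q.2 : E d), q.2) (-s) hs (by simpa using hq)
  simp only [neg_smul, add_neg_cancel_right] at this
  linarith

theorem exitPoint_add (h : IsConvexDomain Ω) {q : E d × S d} (hq : q ∈ phaseDbar Ω) {s : ℝ}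
    (hs : (q.1 + s • (q.2 : E d), q.2) ∈ phaseDbar Ω) :
    exitPoint Ω (q.1 + s • (q.2 : E d), q.2) = exitPoint Ω q := by
  simp only [exitPoint, tauMinus_add h hq hs]
  module

/-! ### Intersections of lines with the interfaces -/

theorem IsAdmissibleDomain.closure_iUnion {N : ℕ} {Ωs : Fin N → Set (E d)}
    (h : IsAdmissibleDomain Ω Ωs) : closure (⋃ j, Ωs j) = closure Ω := by
  rw [closure_iUnion_of_finite, h.closure_eq]

theorem IsAdmissibleDomain.isOpen_iUnion {N : ℕ} {Ωs : Fin N → Set (E d)}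
    (h : IsAdmissibleDomain Ω Ωs) : IsOpen (⋃ j, Ωs j) :=
  _root_.isOpen_iUnion h.sub_isOpen

theorem IsAdmissibleDomain.iUnion_subset {N : ℕ} {Ωs : Fin N → Set (E d)}
    (h : IsAdmissibleDomain Ω Ωs) : (⋃ j, Ωs j) ⊆ Ω :=
  Set.iUnion_subset h.sub_subset

/-- The generalized convexity condition counts crossings of half lines issuing from Ω; the whole
line is two of them, with directions ξ and -ξ, from its point in Ω. -/
theorem IsAdmissibleDomain.finite_line {N : ℕ} {Ωs : Fin N → Set (E d)}
    (h : IsAdmissibleDomain Ω Ωs) {x : E d} {ξ : S d} (hx : ∃ t : ℝ, x + t • (ξ : E d) ∈ Ω) :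
    {r : ℝ | x - r • (ξ : E d) ∈ frontier (⋃ j, Ωs j)}.Finite := by
  obtain ⟨t, ht⟩ := hx
  obtain ⟨L, hL⟩ := h.generalized_convexity
  have hfin : ∀ η : S d, {s : ℝ | 0 ≤ s ∧
      (x + t • (ξ : E d)) - s • (η : E d) ∈ frontier (⋃ j, Ωs j)}.Finite := fun η =>
    Set.finite_of_encard_le_coe (hL _ ht η)
  refine ((((hfin ξ).image fun s => s - t)).union ((hfin (-ξ)).image fun s => -s - t)).subset ?_
  intro r hr
  have hr : x - r • (ξ : E d) ∈ frontier (⋃ j, Ωs j) := hr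
  rcases le_total 0 (r + t) with h0 | h0
  · refine Or.inl ⟨r + t, ⟨h0, ?_⟩, by ring⟩
    convert hr using 1
    module
  · refine Or.inr ⟨-(r + t), ⟨by linarith, ?_⟩, by ring⟩
    convert hr using 1
    have : ((-ξ : S d) : E d) = -(ξ : E d) := rfl
    rw [this]
    module

theorem IsAdmissibleDomain.ae_line {N : ℕ} {Ωs : Fin N → Set (E d)}
    (h : IsAdmissibleDomain Ω Ωs) {x : E d} {ξ : S d} (hx : ∃ t : ℝ, x + t • (ξ : E d) ∈ Ω) :
    ∀ᵐ r : ℝ, x - r • (ξ : E d) ∉ frontier (⋃ j, Ωs j) :=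
  (h.finite_line hx).countable.ae_notMem _

/-! ### Measurability of functions with small oscillation along the directions of a basis -/

/-- Round the `i`-th coordinate with respect to `b` down to a multiple of `1 / (n + 1)`. -/
def roundCoord (b : Module.Basis (Fin d) ℝ (E d)) (i : Fin d) (n : ℕ) (x : E d) : E d :=
  x + ((⌊((n : ℝ) + 1) * b.repr x i⌋ : ℝ) / ((n : ℝ) + 1) - b.repr x i) • b i

/-- The iterated upper limit of `g` along roundings of the coordinates in the list. -/
def roundLimsup (b : Module.Basis (Fin d) ℝ (E d)) (g : E d → ℝ) : List (Fin d) → E d → ℝ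
  | [], x => g x
  | i :: l, x => limsup (fun n : ℕ => roundLimsup b g l (roundCoord b i n x)) atTop

theorem repr_roundCoord_self (b : Module.Basis (Fin d) ℝ (E d)) (i : Fin d) (n : ℕ) (x : E d) :
    b.repr (roundCoord b i n x) i =
      (⌊((n : ℝ) + 1) * b.repr x i⌋ : ℝ) / ((n : ℝ) + 1) := by
  simp [roundCoord]

theorem repr_roundCoord_of_ne (b : Module.Basis (Fin d) ℝ (E d)) {i j : Fin d} (hij : j ≠ i)
    (n : ℕ) (x : E d) : b.repr (roundCoord b i n x) j = b.repr x j := by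
  simp [roundCoord, hij.symm]

theorem measurable_repr (b : Module.Basis (Fin d) ℝ (E d)) (i : Fin d) :
    Measurable fun x => b.repr x i :=
  (LinearMap.continuous_of_finiteDimensional (b.coord i)).measurable

theorem measurable_roundCoord (b : Module.Basis (Fin d) ℝ (E d)) (i : Fin d) (n : ℕ) :
    Measurable (roundCoord b i n) := by
  have h1 := measurable_repr b i
  have h2 : Measurable fun x : E d =>
      (⌊((n : ℝ) + 1) * b.repr x i⌋ : ℝ) / ((n : ℝ) + 1) - b.repr x i :=
    ((measurable_from_top.comp (Int.measurable_floor.comp (h1.const_mul _))).div_const _).sub h1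
  exact measurable_id.add (h2.smul_const _)

theorem measurable_comp_of_countable_range {X : Type*} [MeasurableSpace X] {ψ : X → E d}
    (hψ : Measurable ψ) (hr : (range ψ).Countable) (g : E d → ℝ) : Measurable (g ∘ ψ) := by
  intro s _
  have : (g ∘ ψ) ⁻¹' s = ⋃ y ∈ range ψ ∩ g ⁻¹' s, ψ ⁻¹' {y} := by
    ext x
    simp
  rw [this]
  exact MeasurableSet.biUnion (hr.mono inter_subset_left) fun y _ =>
    hψ (measurableSet_singleton y)

/-- Invariant of the induction: coordinates no longer in the list take countably many values. Once
the list is empty all coordinates do, so nothing need be known about g. -/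
theorem measurable_roundLimsup (b : Module.Basis (Fin d) ℝ (E d)) (g : E d → ℝ) {X : Type*}
    [MeasurableSpace X] (l : List (Fin d)) : ∀ ψ : X → E d, Measurable ψ →
      (∀ j, j ∉ l → (range fun x => b.repr (ψ x) j).Countable) →
      Measurable fun x => roundLimsup b g l (ψ x) := by
  induction l with
  | nil =>
    intro ψ hψ hr
    refine measurable_comp_of_countable_range hψ ?_ g
    have hpi : (univ.pi fun j => range fun x => b.repr (ψ x) j).Countable :=
      Set.countable_univ_pi fun j => hr j (by simp)
    refine (hpi.image b.equivFun.symm).mono ?_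
    rintro _ ⟨x, rfl⟩
    exact ⟨b.equivFun (ψ x), fun j _ => ⟨x, by simp⟩, by simp⟩
  | cons i l ih =>
    intro ψ hψ hr
    refine Measurable.limsup fun n => ih (fun x => roundCoord b i n (ψ x))
      ((measurable_roundCoord b i n).comp hψ) fun j hj => ?_
    by_cases hij : j = i
    · subst hij
      refine (countable_range fun k : ℤ => (k : ℝ) / ((n : ℝ) + 1)).mono ?_
      rintro _ ⟨x, rfl⟩
      exact ⟨_, (repr_roundCoord_self b j n (ψ x)).symm⟩
    · simp only [repr_roundCoord_of_ne b hij]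
      exact hr j (by simp [hij, hj])

theorem tendsto_round_sub (b : Module.Basis (Fin d) ℝ (E d)) (i : Fin d) (x : E d) :
    Tendsto (fun n : ℕ => (⌊((n : ℝ) + 1) * b.repr x i⌋ : ℝ) / ((n : ℝ) + 1) - b.repr x i)
      atTop (𝓝 0) := by
  refine squeeze_zero_norm (fun n => ?_) tendsto_one_div_add_atTop_nhds_zero_nat
  have hn : (0 : ℝ) < (n : ℝ) + 1 := by positivity
  have h1 := Int.floor_le (((n : ℝ) + 1) * b.repr x i)
  have h2 := Int.lt_floor_add_one (((n : ℝ) + 1) * b.repr x i)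
  have : (⌊((n : ℝ) + 1) * b.repr x i⌋ : ℝ) / ((n : ℝ) + 1) - b.repr x i =
      ((⌊((n : ℝ) + 1) * b.repr x i⌋ : ℝ) - ((n : ℝ) + 1) * b.repr x i) / ((n : ℝ) + 1) := by
    field_simp
  rw [this, Real.norm_eq_abs, abs_div, abs_of_pos hn]
  gcongr
  rw [abs_le]
  constructor <;> linarith

theorem tendsto_roundCoord (b : Module.Basis (Fin d) ℝ (E d)) (i : Fin d) (x : E d) :
    Tendsto (fun n : ℕ => roundCoord b i n x) atTop (𝓝 x) := by
  have := ((tendsto_round_sub b i x).smul_const (b i)).const_add x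
  simpa [roundCoord] using this

theorem abs_limsup_sub_le {u : ℕ → ℝ} {a ε : ℝ} (h : ∀ᶠ n in atTop, |u n - a| ≤ ε) :
    |limsup u atTop - a| ≤ ε := by
  have h1 : ∀ᶠ n in atTop, u n ≤ a + ε := h.mono fun n hn => by linarith [(abs_le.1 hn).2]
  have h2 : ∀ᶠ n in atTop, a - ε ≤ u n := h.mono fun n hn => by linarith [(abs_le.1 hn).1]
  have hb : IsBoundedUnder (· ≤ ·) atTop u := ⟨_, h1⟩
  have hb' : IsBoundedUnder (· ≥ ·) atTop u := ⟨_, h2⟩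
  have h3 : limsup u atTop ≤ a + ε := limsup_le_of_le hb'.isCoboundedUnder_le h1
  have h4 : a - ε ≤ limsup u atTop := le_limsup_of_frequently_le h2.frequently hb
  rw [abs_le]
  constructor <;> linarith

/-- Each rounding is a small move along one basis vector, so it costs ε; since V is open, the
rounded points eventually stay where the hypothesis applies. -/
theorem abs_roundLimsup_sub_le (b : Module.Basis (Fin d) ℝ (E d)) {g : E d → ℝ} {V : Set (E d)}
    (hV : IsOpen V) {ε : ℝ} (hg : ∀ x ∈ V, ∀ i, ∀ᶠ t : ℝ in 𝓝 0, |g (x + t • b i) - g x| ≤ ε)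
    (l : List (Fin d)) :
    ∀ x ∈ V, |roundLimsup b g l x - g x| ≤ l.length * ε := by
  induction l with
  | nil => simp [roundLimsup]
  | cons i l ih =>
    intro x hx
    refine abs_limsup_sub_le ?_
    filter_upwards [(tendsto_roundCoord b i x).eventually (hV.mem_nhds hx),
      (tendsto_round_sub b i x).eventually (hg x hx i)] with n hn1 hn2
    have h1 := ih _ hn1
    have h2 : |g (roundCoord b i n x) - g x| ≤ ε := hn2
    calc _ ≤ |roundLimsup b g l (roundCoord b i n x) - g (roundCoord b i n x)| +
          |g (roundCoord b i n x) - g x| := abs_sub_le _ _ _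
      _ ≤ l.length * ε + ε := add_le_add h1 h2
      _ = _ := by push_cast [List.length_cons]; ring

/-- The basis may depend on ε: the rounded upper limits are measurable and within dε of g on V, so g
is their pointwise limit there as ε → 0. -/
theorem measurable_indicator_of_osc {g : E d → ℝ} {V : Set (E d)} (hV : IsOpen V)
    (hg : ∀ ε : ℝ, 0 < ε → ∃ b : Module.Basis (Fin d) ℝ (E d),
      ∀ x ∈ V, ∀ i, ∀ᶠ t : ℝ in 𝓝 0, |g (x + t • b i) - g x| ≤ ε) :
    Measurable (V.indicator g) := by
  have hpos : ∀ m : ℕ, (0 : ℝ) < 1 / ((m : ℝ) + 1) := fun m => by positivity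
  choose b hb using fun m : ℕ => hg _ (hpos m)
  refine measurable_of_tendsto_metrizable (f := fun m : ℕ =>
    V.indicator (roundLimsup (b m) g (List.finRange d))) (fun m => ?_) ?_
  · exact (measurable_roundLimsup (b m) g (List.finRange d) id measurable_id (by simp)).indicator
      hV.measurableSet
  · rw [tendsto_pi_nhds]
    intro x
    by_cases hx : x ∈ V
    · simp only [indicator_of_mem hx]
      rw [tendsto_iff_dist_tendsto_zero]
      have hlim : Tendsto (fun m : ℕ => (d : ℝ) * (1 / ((m : ℝ) + 1))) atTop (𝓝 0) := by
        simpa using tendsto_one_div_add_atTop_nhds_zero_nat.const_mul (d : ℝ)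
      refine squeeze_zero (fun _ => dist_nonneg) (fun m => ?_) hlim
      have := abs_roundLimsup_sub_le (b m) hV (hb m) (List.finRange d) x hx
      rw [List.length_finRange] at this
      exact this
    · simp [indicator_of_notMem hx]

/-- The cone over a ball of directions contains an open neighbourhood of ξ, so these directions span
and contain a basis. -/
theorem exists_basis_near (ξ : S d) {δ : ℝ} (hδ : 0 < δ) :
    ∃ (b : Module.Basis (Fin d) ℝ (E d)) (η : Fin d → S d),
      (∀ i, (η i : E d) = b i) ∧ ∀ i, dist (η i) ξ < δ := by
  set T : Set (E d) := Subtype.val '' (Metric.ball ξ δ) with hT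
  have hspan : ⊤ ≤ Submodule.span ℝ T := by
    set W : Set (E d) := {v | v ≠ 0 ∧ dist (‖v‖⁻¹ • v) (ξ : E d) < δ} with hW
    have hWo : IsOpen W := by
      have hc : ContinuousOn (fun v : E d => dist (‖v‖⁻¹ • v) (ξ : E d)) {v | v ≠ 0} := by
        refine continuous_dist.comp_continuousOn (ContinuousOn.prodMk
          (ContinuousOn.smul (ContinuousOn.inv₀ continuousOn_id.norm
            fun v hv => norm_ne_zero_iff.2 hv) continuousOn_id) continuousOn_const)
      exact hc.isOpen_inter_preimage isOpen_ne isOpen_Iio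
    have hξW : (ξ : E d) ∈ W := by
      refine ⟨?_, by simpa [norm_dir] using hδ⟩
      rw [← norm_ne_zero_iff, norm_dir]
      exact one_ne_zero
    have hsub : W ⊆ Submodule.span ℝ T := by
      intro v hv
      have h0 : ‖v‖ ≠ 0 := norm_ne_zero_iff.2 hv.1
      have hmem : ‖v‖⁻¹ • v ∈ T := by
        refine ⟨⟨‖v‖⁻¹ • v, ?_⟩, ?_, rfl⟩
        · rw [mem_sphere_zero_iff_norm, norm_smul, norm_inv, norm_norm, inv_mul_cancel₀ h0]
        · exact hv.2
      have := Submodule.smul_mem _ ‖v‖ (Submodule.subset_span hmem : _ ∈ Submodule.span ℝ T)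
      rwa [smul_smul, mul_inv_cancel₀ h0, one_smul] at this
    have : Submodule.span ℝ T = ⊤ :=
      Submodule.eq_top_of_nonempty_interior' _ ⟨ξ, interior_maximal hsub hWo hξW⟩
    rw [this]
  let b₀ := Module.Basis.ofSpan hspan
  have hcard : Module.finrank ℝ (E d) = Fintype.card (Fin d) := by simp
  have : Fintype ((linearIndepOn_empty ℝ (id : E d → E d)).extend (empty_subset T)) :=
    FiniteDimensional.fintypeBasisIndex b₀
  have e := Fintype.equivOfCardEq ((Module.finrank_eq_card_basis b₀).symm.trans hcard)
  have hmem : ∀ i, b₀.reindex e i ∈ T := fun i =>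
    Module.Basis.ofSpan_subset hspan ⟨e.symm i, by simp [b₀]⟩
  choose η hη1 hη2 using hmem
  exact ⟨b₀.reindex e, η, hη2, hη1⟩

/-! ### The scattering term -/

/-- The right-hand side of the transport equation. -/
def scatter (μs : E d → ℝ) (p : E d → S d → S d → ℝ) (f : E d × S d → ℝ) (x : E d) (ξ : S d) :
    ℝ :=
  μs x * ∫ ξ', p x ξ ξ' * f (x, ξ') ∂(sphereMeasure d)

instance : IsFiniteMeasure (sphereMeasure d) := by
  unfold sphereMeasure
  infer_instance

section Scatter

variable {Ω₀ : Set (E d)} {μt μs : E d → ℝ} {p : E d → S d → S d → ℝ} {f₀ f : E d × S d → ℝ}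

theorem scatter_eq_zero (hμ : IsAdmissibleMedium Ω₀ μt μs p) {x : E d} (hx : x ∉ Ω₀) (ξ : S d) :
    scatter μs p f x ξ = 0 := by
  simp [scatter, hμ.mus_zero x hx]

theorem exists_scatter_bound (hμ : IsAdmissibleMedium Ω₀ μt μs p) (hsub : Ω₀ ⊆ Ω)
    (hf : IsSolution Ω Ω₀ μt μs p f₀ f) : ∃ C, 0 < C ∧ ∀ x ξ, |scatter μs p f x ξ| ≤ C := by
  obtain ⟨Cs, hCs⟩ := hμ.mus_bounded
  obtain ⟨Cp, hCp⟩ := hμ.p_bounded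
  obtain ⟨Cf, hCf⟩ := hf.bounded
  have hCs' : ∀ x, |μs x| ≤ |Cs| := fun x => by
    rw [abs_of_nonneg (hμ.mus_nonneg x)]
    exact (hCs x).trans (le_abs_self _)
  have hCp' : ∀ x ξ ξ', |p x ξ ξ'| ≤ |Cp| := fun x ξ ξ' => by
    rw [abs_of_nonneg (hμ.p_nonneg x ξ ξ')]
    exact (hCp x ξ ξ').trans (le_abs_self _)
  refine ⟨|Cs| * (|Cp| * |Cf| * (sphereMeasure d).real univ) + 1, by positivity, fun x ξ => ?_⟩
  by_cases hx : x ∈ Ω₀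
  · have h1 : ‖∫ ξ', p x ξ ξ' * f (x, ξ') ∂(sphereMeasure d)‖ ≤
        |Cp| * |Cf| * (sphereMeasure d).real univ := by
      refine norm_integral_le_of_norm_le_const (Eventually.of_forall fun ξ' => ?_)
      rw [norm_mul]
      exact mul_le_mul (hCp' _ _ _) ((hCf _ (Or.inl (hsub hx))).trans (le_abs_self _))
        (norm_nonneg _) (abs_nonneg _)
    rw [scatter, abs_mul]
    have := mul_le_mul (hCs' x) h1 (norm_nonneg _) (abs_nonneg _)
    exact this.trans (by linarith)
  · rw [scatter_eq_zero hμ hx, abs_zero]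
    positivity

/-- The direction enters only through p, which is uniformly continuous on the compact set K × S × S;
boundedness of f does the rest. -/
theorem scatter_modulus (hμ : IsAdmissibleMedium Ω₀ μt μs p) (hsub : Ω₀ ⊆ Ω)
    (hf : IsSolution Ω Ω₀ μt μs p f₀ f) {K : Set (E d)} (hK : IsCompact K) (hK₀ : K ⊆ Ω₀)
    {ε : ℝ} (hε : 0 < ε) : ∃ δ > 0, ∀ x ∈ K, ∀ ξ η : S d, dist ξ η < δ →
      |scatter μs p f x ξ - scatter μs p f x η| ≤ ε := by
  obtain ⟨Cs, hCs⟩ := hμ.mus_bounded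
  obtain ⟨Cf, hCf⟩ := hf.bounded
  set M : ℝ := |Cs| * (|Cf| * (sphereMeasure d).real univ) + 1 with hM
  have hMpos : 0 < M := by positivity
  have huc : UniformContinuousOn (fun z : E d × S d × S d => p z.1 z.2.1 z.2.2)
      (K ×ˢ univ) :=
    (hK.prod isCompact_univ).uniformContinuousOn_of_continuous
      (hμ.p_continuousOn.mono (prod_mono hK₀ subset_rfl))
  obtain ⟨δ, hδ, hp⟩ := Metric.uniformContinuousOn_iff.1 huc (ε / M) (by positivity)
  refine ⟨δ, hδ, fun x hx ξ η hξη => ?_⟩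
  have hle : ∀ ξ', |p x ξ ξ' - p x η ξ'| ≤ ε / M := fun ξ' => by
    refine (hp (x, ξ, ξ') ⟨hx, mem_univ _⟩ (x, η, ξ') ⟨hx, mem_univ _⟩ ?_).le
    simpa [Prod.dist_eq] using hξη
  rw [scatter, scatter, ← mul_sub,
    ← integral_sub (hf.scattering_integrable x (hK₀ hx) ξ)
      (hf.scattering_integrable x (hK₀ hx) η), abs_mul]
  have h1 : ‖∫ ξ', (p x ξ ξ' * f (x, ξ') - p x η ξ' * f (x, ξ')) ∂(sphereMeasure d)‖ ≤
      ε / M * |Cf| * (sphereMeasure d).real univ := by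
    refine norm_integral_le_of_norm_le_const (Eventually.of_forall fun ξ' => ?_)
    rw [← sub_mul, norm_mul]
    exact mul_le_mul (hle ξ') ((hCf _ (Or.inl (hsub (hK₀ hx)))).trans (le_abs_self _))
      (norm_nonneg _) (by positivity)
  have h2 : |μs x| ≤ |Cs| := by
    rw [abs_of_nonneg (hμ.mus_nonneg x)]
    exact (hCs x).trans (le_abs_self _)
  calc _ ≤ |Cs| * (ε / M * |Cf| * (sphereMeasure d).real univ) :=
        mul_le_mul h2 h1 (norm_nonneg _) (abs_nonneg _)
    _ = ε / M * (|Cs| * (|Cf| * (sphereMeasure d).real univ)) := by ring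
    _ ≤ ε / M * M := by gcongr; linarith
    _ = ε := by field_simp

theorem continuous_scatter_dir (hμ : IsAdmissibleMedium Ω₀ μt μs p) (hsub : Ω₀ ⊆ Ω)
    (hf : IsSolution Ω Ω₀ μt μs p f₀ f) (x : E d) : Continuous (scatter μs p f x) := by
  by_cases hx : x ∈ Ω₀
  · rw [Metric.continuous_iff]
    intro ξ ε hε
    obtain ⟨δ, hδ, h⟩ := scatter_modulus hμ hsub hf (isCompact_singleton (x := x))
      (by simpa using hx) (half_pos hε)
    exact ⟨δ, hδ, fun η hη => (h x rfl η ξ hη).trans_lt (half_lt_self hε)⟩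
  · have : scatter μs p f x = fun _ => 0 := funext fun ξ => scatter_eq_zero hμ hx ξ
    rw [this]
    exact continuous_const

/-- The equation is read backwards: the scattering term equals ξ · ∇f + μt f, and each of these
functions is continuous along the line in direction ξ. -/
theorem continuousAt_scatter_line (hμ : IsAdmissibleMedium Ω₀ μt μs p) (hO : IsOpen Ω₀)
    (hsub : Ω₀ ⊆ Ω) (hf : IsSolution Ω Ω₀ μt μs p f₀ f) {x : E d} (hx : x ∈ Ω₀) (ξ : S d) :
    ContinuousAt (fun t : ℝ => scatter μs p f (x + t • (ξ : E d)) ξ) 0 := by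
  have hline : Continuous fun t : ℝ => x + t • (ξ : E d) := by fun_prop
  have hline' : Continuous fun t : ℝ => x - t • (ξ : E d) := by fun_prop
  have hev : ∀ᶠ t : ℝ in 𝓝 0, x + t • (ξ : E d) ∈ Ω₀ :=
    hline.continuousAt.eventually (hO.mem_nhds (by simpa using hx))
  have hev' : ∀ᶠ t : ℝ in 𝓝 0, x - t • (ξ : E d) ∈ Ω₀ :=
    hline'.continuousAt.eventually (hO.mem_nhds (by simpa using hx))
  have h1 : ContinuousAt (fun t : ℝ => dirDeriv f (x + t • (ξ : E d)) ξ) 0 := by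
    have h := (hf.deriv_continuous_along x hx ξ).continuousAt hev'
    have hn : ContinuousAt (fun t : ℝ => -t) 0 := continuous_neg.continuousAt
    have h' : ContinuousAt (fun t : ℝ => dirDeriv f (x - t • (ξ : E d)) ξ) (-0) := by
      simpa using h
    have := ContinuousAt.comp (f := fun t : ℝ => -t) h' hn
    simpa [Function.comp_def] using this
  have h2 : ContinuousAt (fun t : ℝ => f (x + t • (ξ : E d), ξ)) 0 :=
    (hf.continuous_along (x, ξ) (Or.inl (hsub hx))).continuousAt
      (hev.mono fun t ht => Or.inl (hsub ht))
  have h3 : ContinuousAt (fun t : ℝ => μt (x + t • (ξ : E d))) 0 := by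
    have : ContinuousAt μt (x + (0 : ℝ) • (ξ : E d)) := by
      simpa using hμ.mut_continuousOn.continuousAt (hO.mem_nhds hx)
    exact ContinuousAt.comp (f := fun t : ℝ => x + t • (ξ : E d)) this hline.continuousAt
  refine (h1.add (h3.mul h2)).congr ?_
  filter_upwards [hev] with t ht
  exact hf.equation _ ht ξ

theorem measurable_scatter (hμ : IsAdmissibleMedium Ω₀ μt μs p) (hO : IsOpen Ω₀)
    (hb : Bornology.IsBounded Ω₀) (hsub : Ω₀ ⊆ Ω) (hf : IsSolution Ω Ω₀ μt μs p f₀ f) (ξ : S d) :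
    Measurable fun x => scatter μs p f x ξ := by
  -- Exhaustion of Ω₀ by open sets lying in compact subsets, on which the modulus in the direction
  -- is uniform.
  have hVo : ∀ m : ℕ, IsOpen {x | 1 / ((m : ℝ) + 1) < Metric.infDist x Ω₀ᶜ} := fun m =>
    isOpen_lt continuous_const (Metric.continuous_infDist_pt _)
  have hne : (Ω₀ᶜ).Nonempty := by
    have : Nontrivial (E d) := ⟨ξ, 0, by rw [← norm_ne_zero_iff, norm_dir]; exact one_ne_zero⟩
    rw [nonempty_compl]
    rintro rfl
    exact NormedSpace.unbounded_univ ℝ (E d) hb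
  have hK : ∀ m : ℕ, {x | 1 / ((m : ℝ) + 1) ≤ Metric.infDist x Ω₀ᶜ} ⊆ Ω₀ := fun m x hx => by
    by_contra hn
    have h0 : Metric.infDist x Ω₀ᶜ = 0 := Metric.infDist_zero_of_mem hn
    have : 1 / ((m : ℝ) + 1) ≤ 0 := h0 ▸ hx
    have h2 : (0 : ℝ) < 1 / ((m : ℝ) + 1) := by positivity
    linarith
  have hKc : ∀ m : ℕ, IsCompact {x | 1 / ((m : ℝ) + 1) ≤ Metric.infDist x Ω₀ᶜ} := fun m =>
    Metric.isCompact_of_isClosed_isBounded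
      (isClosed_le continuous_const (Metric.continuous_infDist_pt _)) (hb.subset (hK m))
  refine measurable_of_tendsto_metrizable (f := fun m : ℕ =>
    indicator {x | 1 / ((m : ℝ) + 1) < Metric.infDist x Ω₀ᶜ} fun x => scatter μs p f x ξ)
    (fun m => ?_) ?_
  · refine measurable_indicator_of_osc (hVo m) fun ε hε => ?_
    obtain ⟨δ, hδ, hmod⟩ := scatter_modulus hμ hsub hf (hKc m) (hK m)
      -- Three errors: replacing ξ by the basis direction, moving along that direction, and
      -- returning to ξ.
      (show 0 < ε / 3 by positivity)
    obtain ⟨b, η, hη, hd⟩ := exists_basis_near ξ hδ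
    refine ⟨b, fun x hx i => ?_⟩
    have hxK : x ∈ {x | 1 / ((m : ℝ) + 1) ≤ Metric.infDist x Ω₀ᶜ} := by
      have hx : 1 / ((m : ℝ) + 1) < Metric.infDist x Ω₀ᶜ := hx
      exact hx.le
    have hline : Continuous fun t : ℝ => x + t • b i := by fun_prop
    have hcont := continuousAt_scatter_line hμ hO hsub hf (hK m hxK) (η i)
    have h1 : ∀ᶠ t : ℝ in 𝓝 0, x + t • b i ∈ {x | 1 / ((m : ℝ) + 1) < Metric.infDist x Ω₀ᶜ} :=
      hline.continuousAt.eventually ((hVo m).mem_nhds (by simpa using hx))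
    have h2 := Metric.tendsto_nhds.1 hcont.tendsto (ε / 3) (by positivity)
    filter_upwards [h1, h2] with t ht1 ht2
    have ht1' : x + t • b i ∈ {x | 1 / ((m : ℝ) + 1) ≤ Metric.infDist x Ω₀ᶜ} := by
      have ht1 : 1 / ((m : ℝ) + 1) < Metric.infDist (x + t • b i) Ω₀ᶜ := ht1
      exact ht1.le
    have e1 := hmod _ ht1' ξ (η i) (by rw [dist_comm]; exact hd i)
    have e2 := hmod _ hxK (η i) ξ (hd i)
    rw [Real.dist_eq, hη] at ht2
    simp only [zero_smul, add_zero] at ht2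
    rw [abs_le] at e1 e2 ⊢
    rw [abs_lt] at ht2
    constructor <;> linarith [e1.1, e1.2, e2.1, e2.2, ht2.1, ht2.2]
  · rw [tendsto_pi_nhds]
    intro x
    by_cases hx : x ∈ Ω₀
    · have hpos : 0 < Metric.infDist x Ω₀ᶜ :=
        (hO.isClosed_compl.notMem_iff_infDist_pos hne).1 (by simpa using hx)
      refine tendsto_const_nhds.congr' ?_
      filter_upwards [tendsto_one_div_add_atTop_nhds_zero_nat.eventually (Iio_mem_nhds hpos)]
        with m hm
      rw [indicator_of_mem]
      exact hm
    · rw [scatter_eq_zero hμ hx]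
      refine tendsto_const_nhds.congr fun m => ?_
      rw [indicator_apply, scatter_eq_zero hμ hx]
      simp

/-- Carathéodory: continuous in the direction and measurable in the point. -/
theorem measurable_uncurry_scatter (hμ : IsAdmissibleMedium Ω₀ μt μs p) (hO : IsOpen Ω₀)
    (hb : Bornology.IsBounded Ω₀) (hsub : Ω₀ ⊆ Ω) (hf : IsSolution Ω Ω₀ μt μs p f₀ f) :
    Measurable fun q : E d × S d => scatter μs p f q.1 q.2 := by
  have := measurable_uncurry_of_continuous_of_measurable
    (u := fun (ξ : S d) (x : E d) => scatter μs p f x ξ)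
    (continuous_scatter_dir hμ hsub hf) (measurable_scatter hμ hO hb hsub hf)
  exact this.comp measurable_swap

end Scatter

/-! ### Optical depth and the integral form of the transport equation -/

/-- The optical depth along the backward half line from `x`. -/
def optDepth (μt : E d → ℝ) (x : E d) (ξ : S d) (s : ℝ) : ℝ :=
  ∫ r in (0 : ℝ)..s, μt (x - r • (ξ : E d))

/-- The integrand of the contribution of the particles that were scattered at least once. -/
def emission (μt : E d → ℝ) (G : E d → S d → ℝ) (x : E d) (ξ : S d) (s : ℝ) : ℝ :=
  Real.exp (-optDepth μt x ξ s) * G (x - s • (ξ : E d)) ξ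

/-- The contribution of the particles that were scattered at least once. -/
def collided (μt : E d → ℝ) (G : E d → S d → ℝ) (R : ℝ) (x : E d) (ξ : S d) : ℝ :=
  ∫ s in (0 : ℝ)..R, emission μt G x ξ s

theorem intervalIntegrable_of_measurable_bounded {g : ℝ → ℝ} (hg : Measurable g) {C : ℝ}
    (hC : ∀ t, |g t| ≤ C) (a b : ℝ) : IntervalIntegrable g volume a b :=
  (intervalIntegrable_const (c := C)).mono_fun hg.aestronglyMeasurable
    (Eventually.of_forall fun t => (hC t).trans (le_abs_self C))

theorem IsAdmissibleMedium.measurable_mut {Ω₀ : Set (E d)} {μt μs : E d → ℝ}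
    {p : E d → S d → S d → ℝ} (hμ : IsAdmissibleMedium Ω₀ μt μs p) (hO : IsOpen Ω₀) :
    Measurable μt := by
  classical
  have h := ContinuousOn.measurable_piecewise hμ.mut_continuousOn
    (continuousOn_const (c := (0 : ℝ)) (s := Ω₀ᶜ)) hO.measurableSet
  convert h using 1
  ext x
  by_cases hx : x ∈ Ω₀
  · simp [hx]
  · simp [hx, hμ.mut_zero x hx]

theorem IsAdmissibleMedium.exists_mut_bound {Ω₀ : Set (E d)} {μt μs : E d → ℝ}
    {p : E d → S d → S d → ℝ} (hμ : IsAdmissibleMedium Ω₀ μt μs p) : ∃ C, ∀ x, |μt x| ≤ C := by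
  obtain ⟨C, hC⟩ := hμ.mut_bounded
  exact ⟨C, fun x => by rw [abs_of_nonneg (hμ.mut_nonneg x)]; exact hC x⟩

theorem mem_or_compl_closure_mem_nhds {Ω₀ : Set (E d)} (hO : IsOpen Ω₀) {x : E d}
    (hx : x ∉ frontier Ω₀) : x ∈ Ω₀ ∨ Ω₀ᶜ ∈ 𝓝 x := by
  rw [hO.frontier_eq] at hx
  by_cases h : x ∈ Ω₀
  · exact Or.inl h
  · right
    have hc : x ∉ closure Ω₀ := fun hc => hx ⟨hc, h⟩
    exact mem_of_superset (isClosed_closure.isOpen_compl.mem_nhds hc)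
      (compl_subset_compl.2 subset_closure)

theorem IsAdmissibleMedium.continuousAt_mut {Ω₀ : Set (E d)} {μt μs : E d → ℝ}
    {p : E d → S d → S d → ℝ} (hμ : IsAdmissibleMedium Ω₀ μt μs p) (hO : IsOpen Ω₀) {x : E d}
    (hx : x ∉ frontier Ω₀) : ContinuousAt μt x := by
  rcases mem_or_compl_closure_mem_nhds hO hx with h | h
  · exact hμ.mut_continuousOn.continuousAt (hO.mem_nhds h)
  · refine (continuousAt_const (y := (0 : ℝ))).congr ?_
    filter_upwards [h] with y hy
    exact (hμ.mut_zero y hy).symm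

section Medium

variable {N : ℕ} {Ωs : Fin N → Set (E d)} {μt μs : E d → ℝ} {p : E d → S d → S d → ℝ}
  {f₀ f : E d × S d → ℝ}

theorem measurable_mut_line (hΩ : IsAdmissibleDomain Ω Ωs)
    (hμ : IsAdmissibleMedium (⋃ j, Ωs j) μt μs p) (x : E d) (ξ : S d) :
    Measurable fun r : ℝ => μt (x - r • (ξ : E d)) :=
  (hμ.measurable_mut hΩ.isOpen_iUnion).comp (by fun_prop)

theorem intervalIntegrable_mut_line (hΩ : IsAdmissibleDomain Ω Ωs)
    (hμ : IsAdmissibleMedium (⋃ j, Ωs j) μt μs p) (x : E d) (ξ : S d) (a b : ℝ) :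
    IntervalIntegrable (fun r : ℝ => μt (x - r • (ξ : E d))) volume a b := by
  obtain ⟨C, hC⟩ := hμ.exists_mut_bound
  exact intervalIntegrable_of_measurable_bounded (measurable_mut_line hΩ hμ x ξ) (fun _ => hC _) a b

theorem continuous_optDepth (hΩ : IsAdmissibleDomain Ω Ωs)
    (hμ : IsAdmissibleMedium (⋃ j, Ωs j) μt μs p) (x : E d) (ξ : S d) :
    Continuous (optDepth μt x ξ) :=
  intervalIntegral.continuous_primitive (fun a b => intervalIntegrable_mut_line hΩ hμ x ξ a b) 0

theorem optDepth_nonneg (hμ : IsAdmissibleMedium (⋃ j, Ωs j) μt μs p) (x : E d) (ξ : S d) {s : ℝ}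
    (hs : 0 ≤ s) : 0 ≤ optDepth μt x ξ s :=
  intervalIntegral.integral_nonneg hs fun _ _ => hμ.mut_nonneg _

theorem exp_optDepth_le_one (hμ : IsAdmissibleMedium (⋃ j, Ωs j) μt μs p) (x : E d) (ξ : S d)
    {s : ℝ} (hs : 0 ≤ s) : Real.exp (-optDepth μt x ξ s) ≤ 1 :=
  Real.exp_le_one_iff.2 (neg_nonpos.2 (optDepth_nonneg hμ x ξ hs))

theorem continuousAt_optDepth (hΩ : IsAdmissibleDomain Ω Ωs)
    (hμ : IsAdmissibleMedium (⋃ j, Ωs j) μt μs p) {x : E d} {ξ : S d} (s : ℝ)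
    (hx : ∃ t : ℝ, x + t • (ξ : E d) ∈ Ω) :
    ContinuousAt (fun z : (E d × S d) × ℝ => optDepth μt z.1.1 z.1.2 z.2) ((x, ξ), s) := by
  obtain ⟨C, hC⟩ := hμ.exists_mut_bound
  refine intervalIntegral.continuousAt_parametric_primitive_of_dominated (μ := volume)
    (F := fun (q : E d × S d) (r : ℝ) => μt (q.1 - r • (q.2 : E d)))
    -- An interval having both 0 and s in its interior.
    (fun _ => C) (min 0 s - 1) (max 0 s + 1) (fun q => ?_) (Eventually.of_forall fun q => ?_)
    intervalIntegrable_const ?_ ?_ ?_ (by simp)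
  · exact (measurable_mut_line hΩ hμ q.1 q.2).aestronglyMeasurable
  · exact Eventually.of_forall fun t => hC _
  · filter_upwards [ae_restrict_of_ae (hΩ.ae_line hx)] with r hr
    have hl : Continuous fun q : E d × S d => q.1 - r • (q.2 : E d) := by fun_prop
    exact ContinuousAt.comp (f := fun q : E d × S d => q.1 - r • (q.2 : E d)) (x := (x, ξ))
      (hμ.continuousAt_mut hΩ.isOpen_iUnion hr) hl.continuousAt
  · constructor <;> linarith [min_le_left 0 s, le_max_left 0 s]
  · constructor <;> linarith [min_le_right 0 s, le_max_right 0 s]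

theorem abs_emission_le (hμ : IsAdmissibleMedium (⋃ j, Ωs j) μt μs p) {G : E d → S d → ℝ} {C : ℝ}
    (hC : ∀ x ξ, |G x ξ| ≤ C) (x : E d) (ξ : S d) {s : ℝ} (hs : 0 ≤ s) :
    |emission μt G x ξ s| ≤ C := by
  rw [emission, abs_mul, abs_of_nonneg (Real.exp_nonneg _)]
  calc _ ≤ 1 * C := mul_le_mul (exp_optDepth_le_one hμ x ξ hs) (hC _ _) (abs_nonneg _) zero_le_one
    _ = C := one_mul C

theorem measurable_emission (hΩ : IsAdmissibleDomain Ω Ωs)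
    (hμ : IsAdmissibleMedium (⋃ j, Ωs j) μt μs p) {G : E d → S d → ℝ}
    (hG : Measurable fun q : E d × S d => G q.1 q.2) (x : E d) (ξ : S d) :
    Measurable (emission μt G x ξ) := by
  refine Measurable.mul (Real.measurable_exp.comp (continuous_optDepth hΩ hμ x ξ).measurable.neg) ?_
  exact hG.comp (f := fun s : ℝ => (x - s • (ξ : E d), ξ)) (by fun_prop)

/-- The upper limit R does not depend on q, and for almost every s the point x - sξ avoids the
interfaces, where alone the integrand might fail to be continuous. -/
theorem continuousAt_collided (hΩ : IsAdmissibleDomain Ω Ωs)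
    (hμ : IsAdmissibleMedium (⋃ j, Ωs j) μt μs p) {G : E d → S d → ℝ}
    (hG : Measurable fun q : E d × S d => G q.1 q.2) {C : ℝ} (hC : ∀ x ξ, |G x ξ| ≤ C)
    (hGc : ContinuousOn (fun q : E d × S d => G q.1 q.2) ((⋃ j, Ωs j) ×ˢ univ))
    (hG0 : ∀ x ∉ ⋃ j, Ωs j, ∀ ξ, G x ξ = 0) {R : ℝ} (hR : 0 ≤ R) {x : E d} {ξ : S d}
    (hx : ∃ t : ℝ, x + t • (ξ : E d) ∈ Ω) :
    ContinuousAt (fun q : E d × S d => collided μt G R q.1 q.2) (x, ξ) := by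
  have hO := hΩ.isOpen_iUnion
  refine intervalIntegral.continuousAt_of_dominated_interval (bound := fun _ => C)
    (Eventually.of_forall fun q => (measurable_emission hΩ hμ hG q.1 q.2).aestronglyMeasurable)
    (Eventually.of_forall fun q => Eventually.of_forall fun s hs => ?_)
    intervalIntegrable_const ?_
  · rw [uIoc_of_le hR] at hs
    exact abs_emission_le hμ hC _ _ hs.1.le
  · filter_upwards [hΩ.ae_line hx] with s hs _
    have hl : Continuous fun q : E d × S d => (q.1 - s • (q.2 : E d), q.2) := by fun_prop
    refine ContinuousAt.mul ?_ ?_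
    · have h1 := continuousAt_optDepth hΩ hμ s hx
      have h2 : ContinuousAt (fun q : E d × S d => (q, s)) (x, ξ) := by fun_prop
      exact Real.continuous_exp.continuousAt.comp
        (ContinuousAt.comp (f := fun q : E d × S d => (q, s)) h1 h2).neg
    · have h3 : ContinuousAt (fun q : E d × S d => G q.1 q.2) (x - s • (ξ : E d), ξ) := by
        rcases mem_or_compl_closure_mem_nhds hO hs with h | h
        · exact hGc.continuousAt ((hO.prod isOpen_univ).mem_nhds ⟨h, mem_univ _⟩)
        · refine (continuousAt_const (y := (0 : ℝ))).congr ?_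
          filter_upwards [continuousAt_fst.preimage_mem_nhds h] with q hq
          exact (hG0 _ hq _).symm
      exact ContinuousAt.comp_of_eq
        (f := fun q : E d × S d => (q.1 - s • (q.2 : E d), q.2)) h3 hl.continuousAt rfl

theorem eq_ballistic_add_collided_tauMinus (hΩ : IsAdmissibleDomain Ω Ωs)
    (hμ : IsAdmissibleMedium (⋃ j, Ωs j) μt μs p)
    (hf : IsSolution Ω (⋃ j, Ωs j) μt μs p f₀ f) {q : E d × S d} (hq : q ∈ phaseD Ω) :
    f q = f₀ (exitPoint Ω q, q.2) * Real.exp (-optDepth μt q.1 q.2 (tauMinus Ω q)) +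
      collided μt (scatter μs p f) (tauMinus Ω q) q.1 q.2 := by
  obtain ⟨x, ξ⟩ := q
  have hD := hΩ.isConvexDomain
  have hO := hΩ.isOpen_iUnion
  have hcl := ((mem_phaseD_iff hD).1 hq).1
  have hline := ((mem_phaseDbar_iff hD).1 (Or.inl hq)).2
  set τ := tauMinus Ω (x, ξ) with hτ
  have hτ0 : 0 ≤ τ := tauMinus_nonneg _
  have hexit : (exitPoint Ω (x, ξ), ξ) ∈ GammaMinus Ω := exitPoint_mem_GammaMinus hD (Or.inl hq)
  have hmem : ∀ s ∈ Icc 0 τ, (x - s • (ξ : E d), ξ) ∈ phaseD Ω := by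
    rintro s ⟨hs0, hs1⟩
    rcases hs1.eq_or_lt with h | h
    · subst h
      exact Or.inr hexit
    · rcases hs0.eq_or_lt with h' | h'
      · subst h'
        simpa using hq
      · exact Or.inl ((mem_iff_lt_tauMinus hD hcl h').2 h)
  have hcont : ContinuousOn (fun s : ℝ => f (x - s • (ξ : E d), ξ)) (Icc 0 τ) := by
    have h1 := hf.continuous_along _ hq
    have h2 : ContinuousOn (fun s : ℝ => -s) (Icc 0 τ) := continuousOn_neg
    have := h1.comp h2 fun s hs => by
      have := hmem s hs
      simpa [sub_eq_add_neg] using this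
    simpa [Function.comp_def, sub_eq_add_neg] using this
  have hH := continuous_optDepth hΩ hμ x ξ
  -- The integrating factor: absorption cancels in w', leaving minus the emission.
  set w : ℝ → ℝ := fun s => f (x - s • (ξ : E d), ξ) * Real.exp (-optDepth μt x ξ s) with hw
  have hwc : ContinuousOn w (Icc 0 τ) :=
    hcont.mul (Real.continuous_exp.comp hH.neg).continuousOn
  have hderiv : ∀ s ∈ Ioo 0 τ \ {r : ℝ | x - r • (ξ : E d) ∈ frontier (⋃ j, Ωs j)},
      HasDerivAt w (-emission μt (scatter μs p f) x ξ s) s := by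
    rintro s ⟨⟨hs0, hs1⟩, hs⟩
    have hs : x - s • (ξ : E d) ∉ frontier (⋃ j, Ωs j) := hs
    have hs₀ : x - s • (ξ : E d) ∈ ⋃ j, Ωs j := by
      have h1 : x - s • (ξ : E d) ∈ Ω := (mem_iff_lt_tauMinus hD hcl hs0).2 hs1
      have h2 : x - s • (ξ : E d) ∈ closure (⋃ j, Ωs j) := by
        rw [hΩ.closure_iUnion]
        exact subset_closure h1
      rw [hO.frontier_eq] at hs
      by_contra hn
      exact hs ⟨h2, hn⟩
    have hd1 : HasDerivAt (fun r : ℝ => f (x - r • (ξ : E d), ξ))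
        (-dirDeriv f (x - s • (ξ : E d)) ξ) s := by
      have h1 := (hf.differentiable _ hs₀ ξ).hasDerivAt
      have h2 : HasDerivAt (fun t : ℝ => f (x - s • (ξ : E d) + t • (ξ : E d), ξ))
          (dirDeriv f (x - s • (ξ : E d)) ξ) (s - s) := by
        rw [sub_self]
        exact h1
      have h3 := h2.comp_const_sub
      refine h3.congr_of_eventuallyEq (Eventually.of_forall fun r => ?_)
      have : x - r • (ξ : E d) = x - s • (ξ : E d) + (s - r) • (ξ : E d) := by module
      simp only [this]
    have hd2 : HasDerivAt (optDepth μt x ξ) (μt (x - s • (ξ : E d))) s := by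
      have hl : Continuous fun r : ℝ => x - r • (ξ : E d) := by fun_prop
      exact intervalIntegral.integral_hasDerivAt_right (intervalIntegrable_mut_line hΩ hμ x ξ 0 s)
        (measurable_mut_line hΩ hμ x ξ).stronglyMeasurable.stronglyMeasurableAtFilter
        (ContinuousAt.comp (f := fun r : ℝ => x - r • (ξ : E d))
          (hμ.continuousAt_mut hO hs) hl.continuousAt)
    have heq := hf.equation _ hs₀ ξ
    have h5 : scatter μs p f (x - s • (ξ : E d)) ξ = dirDeriv f (x - s • (ξ : E d)) ξ +
      μt (x - s • (ξ : E d)) * f (x - s • (ξ : E d), ξ) := heq.symm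
    refine (hd1.mul hd2.neg.exp).congr_deriv ?_
    simp only [emission, h5, Pi.neg_apply]
    ring
  obtain ⟨C, -, hC⟩ := exists_scatter_bound hμ hΩ.iUnion_subset hf
  have hG := measurable_uncurry_scatter hμ hO (hΩ.bounded.subset hΩ.iUnion_subset)
    hΩ.iUnion_subset hf
  have hint : IntervalIntegrable (fun s => -emission μt (scatter μs p f) x ξ s) volume 0 τ := by
    refine IntervalIntegrable.neg ?_
    refine (intervalIntegrable_const (c := C)).mono_fun
      (measurable_emission hΩ hμ hG x ξ).aestronglyMeasurable ?_
    rw [uIoc_of_le hτ0]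
    filter_upwards [ae_restrict_mem measurableSet_Ioc] with s hs
    exact (abs_emission_le hμ hC x ξ hs.1.le).trans (le_abs_self C)
  -- This form of the fundamental theorem tolerates the finitely many interface crossings, at which
  -- w is only continuous.
  have key := integral_eq_of_hasDerivAt_off_countable_of_le w _ hτ0
    (hΩ.finite_line hline).countable hwc hderiv hint
  rw [intervalIntegral.integral_neg] at key
  have h0 : w 0 = f (x, ξ) := by simp [hw, optDepth]
  have hτw : w τ = f₀ (exitPoint Ω (x, ξ), ξ) * Real.exp (-optDepth μt x ξ τ) := by
    rw [← hf.boundary _ hexit]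
    rfl
  rw [h0, hτw] at key
  simp only [collided]
  linarith

theorem sub_smul_not_mem (hD : IsConvexDomain Ω) {q : E d × S d} (hq : q.1 ∈ closure Ω) {s : ℝ}
    (hs0 : 0 < s) (hs : tauMinus Ω q ≤ s) : q.1 - s • (q.2 : E d) ∉ Ω := fun h =>
  absurd ((mem_iff_lt_tauMinus hD hq hs0).1 h) (not_lt.2 hs)

theorem tauMinus_le (hD : IsConvexDomain Ω) {R : ℝ} (hR0 : 0 < R)
    (hR : ∀ x ∈ closure Ω, ∀ y ∈ closure Ω, dist x y < R) {q : E d × S d} (hq : q.1 ∈ closure Ω) :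
    tauMinus Ω q ≤ R := by
  by_contra hlt
  have := hR _ hq _ (subset_closure ((mem_iff_lt_tauMinus hD hq hR0).2 (not_le.1 hlt)))
  rw [dist_eq_norm, sub_sub_cancel, norm_smul, norm_dir, mul_one, Real.norm_eq_abs,
    abs_of_pos hR0] at this
  exact lt_irrefl _ this

/-- Replaces the variable endpoint τ₋ by a constant, so that continuity in q concerns the integrand
only. -/
theorem integral_tauMinus_eq (hD : IsConvexDomain Ω) {R : ℝ} (hR0 : 0 < R)
    (hR : ∀ x ∈ closure Ω, ∀ y ∈ closure Ω, dist x y < R) {q : E d × S d} (hq : q.1 ∈ closure Ω)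
    {g : ℝ → ℝ} (hg : ∀ s, q.1 - s • (q.2 : E d) ∉ Ω → g s = 0) :
    ∫ s in (0 : ℝ)..tauMinus Ω q, g s = ∫ s in (0 : ℝ)..R, g s := by
  have hτ0 := tauMinus_nonneg (Ω := Ω) q
  have hτ := tauMinus_le hD hR0 hR hq
  rw [intervalIntegral.integral_of_le hτ0, intervalIntegral.integral_of_le hR0.le]
  symm
  refine setIntegral_eq_of_subset_of_forall_sdiff_eq_zero measurableSet_Ioc
    (Ioc_subset_Ioc_right hτ) fun s hs => ?_
  refine hg s (sub_smul_not_mem hD hq hs.1.1 ?_)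
  by_contra hlt
  exact hs.2 ⟨hs.1.1, (not_le.1 hlt).le⟩

theorem eq_ballistic_add_collided (hΩ : IsAdmissibleDomain Ω Ωs)
    (hμ : IsAdmissibleMedium (⋃ j, Ωs j) μt μs p)
    (hf : IsSolution Ω (⋃ j, Ωs j) μt μs p f₀ f) {R : ℝ} (hR0 : 0 < R)
    (hR : ∀ x ∈ closure Ω, ∀ y ∈ closure Ω, dist x y < R) {q : E d × S d} (hq : q ∈ phaseD Ω) :
    f q = f₀ (exitPoint Ω q, q.2) * Real.exp (-optDepth μt q.1 q.2 R) +
      collided μt (scatter μs p f) R q.1 q.2 := by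
  have hD := hΩ.isConvexDomain
  have hcl := ((mem_phaseD_iff hD).1 hq).1
  have h1 : optDepth μt q.1 q.2 (tauMinus Ω q) = optDepth μt q.1 q.2 R :=
    integral_tauMinus_eq hD hR0 hR hcl fun s hs =>
      hμ.mut_zero _ fun h => hs (hΩ.iUnion_subset h)
  have h2 : collided μt (scatter μs p f) (tauMinus Ω q) q.1 q.2 =
      collided μt (scatter μs p f) R q.1 q.2 := by
    refine integral_tauMinus_eq hD hR0 hR hcl fun s hs => ?_
    rw [emission, scatter_eq_zero hμ fun h => hs (hΩ.iUnion_subset h), mul_zero]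
  rw [eq_ballistic_add_collided_tauMinus hΩ hμ hf hq, h1, h2]

end Medium

section ExitDistribution
/-! ### Dependence of the exit distribution on the base point -/

open scoped Pointwise NNReal ENNReal

/-- Lebesgue measure is a multiple of d-dimensional Hausdorff measure, for which the bound is
standard. -/
theorem volume_image_le_of_lipschitzWith {K : ℝ≥0} {g : E d → E d} (hg : LipschitzWith K g)
    (s : Set (E d)) : volume (g '' s) ≤ (K : ℝ≥0∞) ^ d * volume s := by
  set ν : Measure (E d) := Measure.hausdorffMeasure (Module.finrank ℝ (E d) : ℝ) with hν
  have hsm : (volume : Measure (E d)) =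
      Measure.addHaarScalarFactor (volume : Measure (E d)) ν • ν :=
    Measure.isAddLeftInvariant_eq_smul _ _
  have hle : ν (g '' s) ≤ (K : ℝ≥0∞) ^ d * ν s := by
    have := hg.hausdorffMeasure_image_le (d := (Module.finrank ℝ (E d) : ℝ)) (by positivity) s
    have hK : (K : ℝ≥0∞) ^ Module.finrank ℝ (E d) = (K : ℝ≥0∞) ^ d := by
      rw [finrank_euclideanSpace, Fintype.card_fin]
    rwa [ENNReal.rpow_natCast, hK] at this
  rw [hsm]
  simp only [Measure.smul_apply]
  rw [mul_smul_comm]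
  exact smul_le_smul_of_nonneg_left hle zero_le

theorem exitPoint_eq_of_mem_frontier (hD : IsConvexDomain Ω) {x y : E d} (hx : x ∈ Ω)
    (hy : y ∈ frontier Ω) {ξ : S d} {ρ : ℝ} (hρ : 0 < ρ) (hyx : x - ρ • (ξ : E d) = y) :
    exitPoint Ω (x, ξ) = y := by
  have hcl : ((x, ξ) : E d × S d).1 ∈ closure Ω := subset_closure hx
  have hy' : y ∉ Ω := by
    rw [hD.isOpen.frontier_eq] at hy
    exact hy.2
  have h1 : tauMinus Ω (x, ξ) ≤ ρ := by
    by_contra hlt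
    exact hy' (hyx ▸ (mem_iff_lt_tauMinus hD hcl hρ).2 (not_le.1 hlt))
  have h2 : ρ ≤ tauMinus Ω (x, ξ) := by
    by_contra hlt
    obtain ⟨t, ht1, ht2⟩ := exists_between (not_le.1 hlt)
    have ht0 : 0 < t := (tauMinus_nonneg _).trans_lt ht1
    have := hD.between' (x := x) (v := -(ξ : E d)) (a := 0) (b := ρ) (c := t) (by simpa using hx)
      (by rw [smul_neg, ← sub_eq_add_neg, hyx]; exact frontier_subset_closure hy) ht0.le ht2
    rw [smul_neg, ← sub_eq_add_neg] at this
    exact absurd ((mem_iff_lt_tauMinus hD hcl ht0).1 this) (not_lt.2 ht1.le)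
  rw [exitPoint, le_antisymm h1 h2]
  exact hyx

theorem continuous_exitPoint_dir (hD : IsConvexDomain Ω) {x : E d} (hx : x ∈ Ω) :
    Continuous fun ξ : S d => exitPoint Ω (x, ξ) :=
  (continuousOn_exitPoint hD).comp_continuous (by fun_prop) fun _ => Or.inl (Or.inl hx)

/-- Sphere measure is d times the volume of the truncated cone, so cones must be compared. With A =
x₀ - Ω, the positively homogeneous map Θ(v) = v + gauge_A(v)(x - x₀) sends x₀ - y to x - y for y ∈
∂Ω, since the gauge is 1 there. It therefore carries the cone of directions from x₀ that exit in K
onto the corresponding cone from x. -/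
theorem exists_map_exitPoint_le (hD : IsConvexDomain Ω) {x₀ : E d} (hx₀ : x₀ ∈ Ω) :
    ∃ C : ℝ≥0, ∀ᶠ x in 𝓝 x₀, x ∈ Ω ∧
      (sphereMeasure d).map (fun ξ => exitPoint Ω (x, ξ)) ≤
        C • (sphereMeasure d).map (fun ξ => exitPoint Ω (x₀, ξ)) := by
  obtain ⟨R, hR0, hR⟩ := exists_diam_bound hD.bounded
  obtain ⟨ε, hε, hball⟩ := Metric.isOpen_iff.1 hD.isOpen x₀ hx₀
  set r : ℝ := ε / 2 with hr
  have hr0 : 0 < r := half_pos hε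
  -- The first factor comes from the Lipschitz constant 2 of Θ, the second from enlarging the
  -- truncated cone to allow for the different distances to y.
  refine ⟨2 ^ d * (R / r).toNNReal ^ d, ?_⟩
  filter_upwards [Metric.ball_mem_nhds x₀ hr0] with x hx
  have hxr : dist x x₀ < r := hx
  have hxΩ : x ∈ Ω := hball (Metric.ball_subset_ball (by linarith) hx)
  refine ⟨hxΩ, Measure.le_intro fun K hK _ => ?_⟩
  have hm := (continuous_exitPoint_dir hD hxΩ).measurable
  have hm₀ := (continuous_exitPoint_dir hD hx₀).measurable
  set A : Set (E d) := (Homeomorph.subLeft x₀) ⁻¹' Ω with hA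
  have hAc : Convex ℝ A := by
    intro v hv w hw a b ha hb hab
    have := hD.convex hv hw ha hb hab
    simp only [hA, mem_preimage, Homeomorph.subLeft_apply] at this ⊢
    convert this using 1
    have hb' : b = 1 - a := by linarith
    subst hb'
    module
  have hAball : Metric.ball 0 ((2 * r).toNNReal : ℝ) ⊆ A := by
    intro v hv
    rw [Real.coe_toNNReal _ (by positivity), mem_ball_zero_iff] at hv
    apply hball
    rw [Homeomorph.subLeft_apply, mem_ball_iff_norm, sub_sub_cancel_left, norm_neg]
    linarith
  have hApos : 0 < (2 * r).toNNReal := Real.toNNReal_pos.2 (by positivity)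
  have hgl := hAc.lipschitzWith_gauge hApos hAball
  set Θ : E d → E d := fun v => v + gauge A v • (x - x₀) with hΘ
  -- A contains the ball of radius 2r, so its gauge is 1/(2r)-Lipschitz; as |x - x₀| < r, the
  -- perturbation contributes at most 1/2.
  have hΘl : LipschitzWith 2 Θ := by
    refine LipschitzWith.of_dist_le_mul fun v w => ?_
    have h1 : |gauge A v - gauge A w| ≤ (2 * r)⁻¹ * dist v w := by
      have := hgl.dist_le_mul v w
      rwa [NNReal.coe_inv, Real.coe_toNNReal _ (by positivity)] at this
    have h2 : Θ v - Θ w = (v - w) + (gauge A v - gauge A w) • (x - x₀) := by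
      simp only [hΘ]
      module
    rw [dist_eq_norm, h2]
    refine (norm_add_le _ _).trans ?_
    rw [norm_smul, ← dist_eq_norm, ← dist_eq_norm x x₀, Real.norm_eq_abs]
    have h3 : |gauge A v - gauge A w| * dist x x₀ ≤ ((2 * r)⁻¹ * dist v w) * r :=
      mul_le_mul h1 hxr.le dist_nonneg (by positivity)
    have h4 : ((2 * r)⁻¹ * dist v w) * r = dist v w / 2 := by field_simp
    have h5 := dist_nonneg (x := v) (y := w)
    push_cast
    linarith
  have hsub : Ioo (0 : ℝ) 1 • (Subtype.val '' ((fun ξ => exitPoint Ω (x, ξ)) ⁻¹' K)) ⊆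
      Θ '' ((R / r) • (Ioo (0 : ℝ) 1 •
        (Subtype.val '' ((fun ξ => exitPoint Ω (x₀, ξ)) ⁻¹' K)))) := by
    rintro _ ⟨t, ⟨ht0, ht1⟩, _, ⟨ξ', hξ', rfl⟩, rfl⟩
    have hcl : ((x, ξ') : E d × S d).1 ∈ closure Ω := subset_closure hxΩ
    set y := exitPoint Ω (x, ξ') with hy
    have hyf : y ∈ frontier Ω := exitPoint_mem_frontier hD hcl
    set τ := tauMinus Ω (x, ξ') with hτ
    have hyτ : x - y = τ • (ξ' : E d) := by
      rw [hy, exitPoint, sub_sub_cancel]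
    have hrτ : r ≤ τ := by
      by_contra hlt
      obtain ⟨s, hs1, hs2⟩ := exists_between (not_le.1 hlt)
      have hs0 : 0 < s := (tauMinus_nonneg _).trans_lt hs1
      have : x - s • (ξ' : E d) ∈ Ω := by
        apply hball
        rw [Metric.mem_ball]
        calc dist (x - s • (ξ' : E d)) x₀ ≤ dist (x - s • (ξ' : E d)) x + dist x x₀ :=
              dist_triangle _ _ _
          _ = s + dist x x₀ := by
              rw [dist_eq_norm, sub_sub_cancel_left, norm_neg, norm_smul, norm_dir, mul_one,
                Real.norm_eq_abs, abs_of_pos hs0]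
          _ < ε := by linarith
      exact absurd ((mem_iff_lt_tauMinus hD hcl hs0).1 this) (not_lt.2 hs1.le)
    have hτ0 : 0 < τ := hr0.trans_le hrτ
    have hyx₀ : x₀ - y ≠ 0 := by
      intro h0
      rw [hD.isOpen.frontier_eq] at hyf
      exact hyf.2 (sub_eq_zero.1 h0 ▸ hx₀)
    set ρ := ‖x₀ - y‖ with hρ
    have hρ0 : 0 < ρ := norm_pos_iff.2 hyx₀
    have hρR : ρ < R := by
      rw [hρ, ← dist_eq_norm]
      exact hR _ (subset_closure hx₀) _ (frontier_subset_closure hyf)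
    let ξ : S d := ⟨ρ⁻¹ • (x₀ - y), by
      rw [mem_sphere_zero_iff_norm, norm_smul, norm_inv, norm_norm, inv_mul_cancel₀ hρ0.ne']⟩
    have hξ : ρ • (ξ : E d) = x₀ - y := by
      simp only [ξ, smul_smul, mul_inv_cancel₀ hρ0.ne', one_smul]
    have hex : exitPoint Ω (x₀, ξ) = y :=
      exitPoint_eq_of_mem_frontier hD hx₀ hyf hρ0 (by rw [hξ, sub_sub_cancel])
    have hgauge : gauge A (x₀ - y) = 1 := by
      rw [gauge_eq_one_iff_mem_frontier hAc
        (mem_of_superset (Metric.ball_mem_nhds 0 (NNReal.coe_pos.2 hApos)) hAball), hA,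
        ← Homeomorph.preimage_frontier]
      simpa using hyf
    -- Θ maps this to (t/τ)(x - y) = tξ'. Its length tρ/τ is below R/r because ρ < R, r ≤ τ and t <
    -- 1.
    refine ⟨(t / τ) • (x₀ - y), ?_, ?_⟩
    · refine ⟨(t * ρ * r / (τ * R)) • (ξ : E d), ⟨t * ρ * r / (τ * R), ⟨by positivity, ?_⟩,
        ξ, ⟨ξ, ?_, rfl⟩, rfl⟩, ?_⟩
      · rw [div_lt_one (by positivity)]
        calc t * ρ * r ≤ t * ρ * τ := by gcongr
          _ < 1 * R * τ := by gcongr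
          _ = τ * R := by ring
      · rw [mem_preimage, hex]
        exact hξ'
      · simp only [← hξ, smul_smul]
        congr 1
        field_simp
    · simp only [hΘ]
      rw [gauge_smul_of_nonneg (by positivity), hgauge]
      have : (t / τ) • (x₀ - y) + ((t / τ) • (1 : ℝ)) • (x - x₀) = (t / τ) • (x - y) := by
        simp only [smul_eq_mul, mul_one]
        module
      rw [this, hyτ, smul_smul, div_mul_cancel₀ _ hτ0.ne']
  have hvol := (measure_mono hsub).trans (volume_image_le_of_lipschitzWith hΘl _)
  rw [Measure.addHaar_smul] at hvol
  rw [Measure.smul_apply, Measure.map_apply hm hK, Measure.map_apply hm₀ hK, sphereMeasure,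
    Measure.toSphere_apply' _ (hm hK), Measure.toSphere_apply' _ (hm₀ hK)]
  refine (mul_le_mul_right hvol _).trans (le_of_eq ?_)
  have hfr : Module.finrank ℝ (E d) = d := by simp
  rw [hfr, abs_of_nonneg (by positivity), ENNReal.ofReal_pow (by positivity)]
  rw [ENNReal.smul_def, smul_eq_mul]
  push_cast
  rw [ENNReal.ofReal]
  ring

/-- The indicator is approximated in L¹ of the exit distribution at x₀ by a continuous g. The
domination makes the same g good at all nearby x, and for g itself dominated convergence applies. -/
theorem tendsto_lintegral_indicator_exitPoint (hD : IsConvexDomain Ω) {x₀ : E d} (hx₀ : x₀ ∈ Ω)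
    {K : Set (E d)} (hK : MeasurableSet K) :
    Tendsto (fun x => ∫⁻ ξ : S d, ‖K.indicator (fun _ => (1 : ℝ)) (exitPoint Ω (x, ξ)) -
        K.indicator (fun _ => (1 : ℝ)) (exitPoint Ω (x₀, ξ))‖ₑ ∂(sphereMeasure d))
      (𝓝 x₀) (𝓝 0) := by
  obtain ⟨C, hC⟩ := exists_map_exitPoint_le hD hx₀
  set k : E d → ℝ := K.indicator fun _ => (1 : ℝ) with hk
  have hkm : Measurable k := measurable_const.indicator hK
  have hm₀ := (continuous_exitPoint_dir hD hx₀).measurable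
  set ν := (sphereMeasure d).map (fun ξ => exitPoint Ω (x₀, ξ)) with hν
  have hkint : Integrable k ν := (integrable_const (1 : ℝ)).indicator hK
  rw [ENNReal.tendsto_nhds_zero]
  intro ε hε
  -- The approximation error is at most Cδ at x and δ at x₀.
  set δ : ℝ≥0∞ := ε / 2 / (C + 1) with hδ
  have hδ0 : δ ≠ 0 := by
    rw [hδ]
    refine (ENNReal.div_pos (ENNReal.div_pos hε.ne' (by simp)).ne' (by simp)).ne'
  obtain ⟨g, hgs, hgk, hgc, -⟩ := hkint.exists_hasCompactSupport_lintegral_sub_le hδ0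
  obtain ⟨M, hM⟩ := hgs.exists_bound_of_continuous hgc
  have hmid : Tendsto (fun x => ∫⁻ ξ : S d, ‖g (exitPoint Ω (x, ξ)) -
      g (exitPoint Ω (x₀, ξ))‖ₑ ∂(sphereMeasure d)) (𝓝 x₀) (𝓝 0) := by
    have h0 : (∫⁻ _ : S d, (0 : ℝ≥0∞) ∂(sphereMeasure d)) = 0 := by simp
    rw [← h0]
    refine tendsto_lintegral_filter_of_dominated_convergence (fun _ => ENNReal.ofReal (M + M))
      ?_ ?_ ?_ ?_
    · filter_upwards [hD.isOpen.mem_nhds hx₀] with x hx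
      exact (((hgc.comp (continuous_exitPoint_dir hD hx)).sub
        (hgc.comp (continuous_exitPoint_dir hD hx₀))).enorm).measurable
    · refine Eventually.of_forall fun x => Eventually.of_forall fun ξ => ?_
      rw [← ofReal_norm]
      exact ENNReal.ofReal_le_ofReal ((norm_sub_le _ _).trans (add_le_add (hM _) (hM _)))
    · simp only [lintegral_const]
      exact ENNReal.mul_ne_top ENNReal.ofReal_ne_top (measure_ne_top _ _)
    · refine Eventually.of_forall fun ξ => ?_
      have h1 : ContinuousAt (fun x => exitPoint Ω (x, ξ)) x₀ := by
        have h2 : ContinuousWithinAt (exitPoint Ω) (phaseDbar Ω) (x₀, ξ) :=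
          continuousOn_exitPoint hD _ (Or.inl (Or.inl hx₀))
        have h3 : ContinuousAt (fun x : E d => (x, ξ)) x₀ := by fun_prop
        have h4 := h2.comp_of_preimage_mem_nhdsWithin (f := fun x : E d => (x, ξ)) (s := Ω)
          h3.continuousWithinAt (mem_of_superset self_mem_nhdsWithin
            fun x hx => Or.inl (Or.inl hx))
        exact h4.continuousAt (hD.isOpen.mem_nhds hx₀)
      have h5 : ContinuousAt (fun x => ‖g (exitPoint Ω (x, ξ)) - g (exitPoint Ω (x₀, ξ))‖ₑ) x₀ :=
        ((hgc.continuousAt.comp h1).sub continuousAt_const).enorm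
      simpa using h5.tendsto
  have hmid' := (ENNReal.tendsto_nhds_zero.1 hmid) (ε / 2) (ENNReal.div_pos hε.ne' (by simp))
  filter_upwards [hC, hmid'] with x hx1 hx2
  obtain ⟨hxΩ, hle⟩ := hx1
  have hm := (continuous_exitPoint_dir hD hxΩ).measurable
  have hsub : Measurable fun y => ‖k y - g y‖ₑ := (hkm.sub hgc.measurable).enorm
  have e1 : ∫⁻ ξ : S d, ‖k (exitPoint Ω (x, ξ)) - g (exitPoint Ω (x, ξ))‖ₑ ∂(sphereMeasure d)
      ≤ C * δ := by
    rw [← lintegral_map hsub hm]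
    refine (lintegral_mono' hle le_rfl).trans ?_
    rw [lintegral_smul_measure, ENNReal.smul_def, smul_eq_mul]
    gcongr
  have e2 : ∫⁻ ξ : S d, ‖k (exitPoint Ω (x₀, ξ)) - g (exitPoint Ω (x₀, ξ))‖ₑ ∂(sphereMeasure d)
      ≤ δ := by
    rw [← lintegral_map hsub hm₀]
    exact hgk
  have hmeas1 : Measurable fun ξ : S d => ‖k (exitPoint Ω (x, ξ)) - g (exitPoint Ω (x, ξ))‖ₑ :=
    hsub.comp hm
  have hmeas2 : Measurable fun ξ : S d =>
      ‖k (exitPoint Ω (x₀, ξ)) - g (exitPoint Ω (x₀, ξ))‖ₑ := hsub.comp hm₀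
  calc _ ≤ ∫⁻ ξ : S d, (‖k (exitPoint Ω (x, ξ)) - g (exitPoint Ω (x, ξ))‖ₑ +
        ‖k (exitPoint Ω (x₀, ξ)) - g (exitPoint Ω (x₀, ξ))‖ₑ +
        ‖g (exitPoint Ω (x, ξ)) - g (exitPoint Ω (x₀, ξ))‖ₑ) ∂(sphereMeasure d) := by
        refine lintegral_mono fun ξ => ?_
        have : k (exitPoint Ω (x, ξ)) - k (exitPoint Ω (x₀, ξ)) =
          (k (exitPoint Ω (x, ξ)) - g (exitPoint Ω (x, ξ))) -
          (k (exitPoint Ω (x₀, ξ)) - g (exitPoint Ω (x₀, ξ))) +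
          (g (exitPoint Ω (x, ξ)) - g (exitPoint Ω (x₀, ξ))) := by ring
        simp only
        rw [this]
        exact (enorm_add_le _ _).trans (add_le_add_left enorm_sub_le _)
    _ = _ := by
        rw [← lintegral_add_left hmeas1]
        exact lintegral_add_left (hmeas1.add hmeas2) _
    _ ≤ C * δ + δ + ε / 2 := add_le_add (add_le_add e1 e2) hx2
    _ = (C + 1) * δ + ε / 2 := by ring
    _ ≤ ε / 2 + ε / 2 := add_le_add_left ENNReal.mul_div_le _
    _ = ε := ENNReal.add_halves ε

end ExitDistribution

/-! ### Polar coordinates -/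

open Classical in
/-- The direction of a vector, with the value `ξ₀` at `0`. -/
def unitDir (ξ₀ : S d) (v : E d) : S d :=
  ⟨if v = 0 then (ξ₀ : E d) else ‖v‖⁻¹ • v, by
    split_ifs with h
    · exact ξ₀.2
    · rw [mem_sphere_zero_iff_norm, norm_smul, norm_inv, norm_norm,
        inv_mul_cancel₀ (norm_ne_zero_iff.2 h)]⟩

theorem norm_smul_unitDir (ξ₀ : S d) (v : E d) : ‖v‖ • (unitDir ξ₀ v : E d) = v := by
  by_cases h : v = 0
  · simp [h]
  · simp [unitDir, h, smul_smul]

theorem measurable_unitDir (ξ₀ : S d) : Measurable (unitDir ξ₀) := by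
  refine Measurable.subtype_mk ?_
  exact Measurable.ite (measurableSet_singleton (0 : E d)) measurable_const
    (measurable_norm.inv.smul measurable_id)

theorem continuousAt_unitDir (ξ₀ : S d) {v : E d} (hv : v ≠ 0) :
    ContinuousAt (unitDir ξ₀) v := by
  rw [Topology.IsInducing.subtypeVal.continuousAt_iff]
  have h1 : ContinuousAt (fun w : E d => ‖w‖⁻¹ • w) v :=
    (continuousAt_id.norm.inv₀ (norm_ne_zero_iff.2 hv)).smul continuousAt_id
  refine h1.congr ?_
  filter_upwards [isOpen_ne.mem_nhds hv] with w hw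
  have hw : w ≠ 0 := hw
  simp [unitDir, hw]

/-- The density r^(d-1) of the radial measure cancels the weight. Each change of variables is along
a measurable embedding or a density, so u may be arbitrary. -/
theorem integral_polar (ξ₀ : S d) (u : S d → ℝ → ℝ) :
    ∫ z : S d × ℝ, u z.1 z.2 ∂((sphereMeasure d).prod (volume.restrict (Ioi (0 : ℝ)))) =
      ∫ v : E d, (‖v‖ ^ (d - 1))⁻¹ * u (unitDir ξ₀ v) ‖v‖ := by
  have hnt : Nontrivial (E d) := ⟨ξ₀, 0, by rw [← norm_ne_zero_iff, norm_dir]; exact one_ne_zero⟩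
  have hfr : Module.finrank ℝ (E d) = d := by simp
  have hsf : SigmaFinite ((volume : Measure ℝ).comap (Subtype.val : Ioi (0 : ℝ) → ℝ)) := by
    refine SigmaFinite.of_map _ measurable_subtype_coe.aemeasurable ?_
    rw [map_comap_subtype_coe measurableSet_Ioi]
    infer_instance
  symm
  calc ∫ v : E d, (‖v‖ ^ (d - 1))⁻¹ * u (unitDir ξ₀ v) ‖v‖
      = ∫ v : ({(0 : E d)}ᶜ : Set (E d)), (‖(v : E d)‖ ^ (d - 1))⁻¹ * u (unitDir ξ₀ v) ‖(v : E d)‖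
          ∂((volume : Measure (E d)).comap Subtype.val) := by
        rw [integral_subtype_comap (measurableSet_singleton _).compl
          fun v : E d => (‖v‖ ^ (d - 1))⁻¹ * u (unitDir ξ₀ v) ‖v‖, restrict_compl_singleton]
    _ = ∫ z : S d × Ioi (0 : ℝ), ((z.2 : ℝ) ^ (d - 1))⁻¹ * u z.1 z.2
          ∂((sphereMeasure d).prod (Measure.volumeIoiPow (d - 1))) := by
        have h := (volume : Measure (E d)).measurePreserving_homeomorphUnitSphereProd.integral_comp
          (Homeomorph.measurableEmbedding _)
          (fun z : S d × Ioi (0 : ℝ) => ((z.2 : ℝ) ^ (d - 1))⁻¹ * u z.1 z.2)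
        rw [hfr] at h
        rw [sphereMeasure, ← h]
        refine integral_congr_ae (Eventually.of_forall fun v => ?_)
        have hv : (v : E d) ≠ 0 := v.2
        have hdir : ((homeomorphUnitSphereProd (E d)) v).1 = unitDir ξ₀ v := by
          ext1
          simp [unitDir, hv]
        simp only [hdir, homeomorphUnitSphereProd_apply_snd_coe]
    _ = ∫ z : S d × Ioi (0 : ℝ), u z.1 z.2
          ∂((sphereMeasure d).prod ((volume : Measure ℝ).comap Subtype.val)) := by
        have hm : Measurable fun r : Ioi (0 : ℝ) => ((r : ℝ) ^ (d - 1)).toNNReal :=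
          (measurable_subtype_coe.pow_const _).real_toNNReal
        have : (sphereMeasure d).prod (Measure.volumeIoiPow (d - 1)) =
            ((sphereMeasure d).prod ((volume : Measure ℝ).comap
              (Subtype.val : Ioi (0 : ℝ) → ℝ))).withDensity
              fun z => ((((z.2 : ℝ) ^ (d - 1)).toNNReal : NNReal) : ENNReal) := by
          rw [Measure.volumeIoiPow]
          exact prod_withDensity_right hm.coe_nnreal_ennreal
        rw [this]
        refine (integral_withDensity_eq_integral_smul
          (f := fun z : S d × Ioi (0 : ℝ) => ((z.2 : ℝ) ^ (d - 1)).toNNReal)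
          (hm.comp measurable_snd) _).trans ?_
        refine integral_congr_ae (Eventually.of_forall fun z => ?_)
        have hz : (0 : ℝ) < z.2 := z.2.2
        simp only [NNReal.smul_def, smul_eq_mul]
        rw [Real.coe_toNNReal _ (by positivity), mul_inv_cancel_left₀ (by positivity)]
    _ = _ := by
        have hemb : MeasurableEmbedding (Subtype.val : Ioi (0 : ℝ) → ℝ) :=
          MeasurableEmbedding.subtype_coe measurableSet_Ioi
        have hmap : (sphereMeasure d).prod (volume.restrict (Ioi (0 : ℝ))) =
            ((sphereMeasure d).prod ((volume : Measure ℝ).comap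
              (Subtype.val : Ioi (0 : ℝ) → ℝ))).map (Prod.map id Subtype.val) := by
          rw [← Measure.map_prod_map _ _ measurable_id measurable_subtype_coe, Measure.map_id,
            map_comap_subtype_coe measurableSet_Ioi]
        rw [hmap, (MeasurableEmbedding.id.prodMap hemb).integral_map]
        rfl

/-! ### Averages of the scattered part over directions -/

/-- A continuous cutoff vanishing on `(-∞, δ]` and equal to `1` on `[2 δ, ∞)`. -/
def cutoff (δ s : ℝ) : ℝ := min 1 (max 0 (s / δ - 1))

theorem continuous_cutoff (δ : ℝ) : Continuous (cutoff δ) := by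
  unfold cutoff
  fun_prop

theorem cutoff_nonneg (δ s : ℝ) : 0 ≤ cutoff δ s := le_min zero_le_one (le_max_left _ _)

theorem cutoff_le_one (δ s : ℝ) : cutoff δ s ≤ 1 := min_le_left _ _

theorem cutoff_eq_zero {δ s : ℝ} (hδ : 0 < δ) (hs : s ≤ δ) : cutoff δ s = 0 := by
  have : s / δ - 1 ≤ 0 := by linarith [(div_le_one hδ).2 hs]
  simp [cutoff, max_eq_left this]

theorem cutoff_eq_one {δ s : ℝ} (hδ : 0 < δ) (hs : 2 * δ ≤ s) : cutoff δ s = 1 := by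
  have : 1 ≤ s / δ - 1 := by linarith [(le_div_iff₀ hδ).2 hs]
  rw [cutoff, max_eq_right (by linarith), min_eq_left this]

section Average

variable {N : ℕ} {Ωs : Fin N → Set (E d)} {μt μs : E d → ℝ} {p : E d → S d → S d → ℝ}
  {G : E d → S d → ℝ} {C : ℝ}

theorem continuous_optDepth_uncurry (hΩ : IsAdmissibleDomain Ω Ωs)
    (hμ : IsAdmissibleMedium (⋃ j, Ωs j) μt μs p) {x : E d} (hx : x ∈ Ω) :
    Continuous fun z : S d × ℝ => optDepth μt x z.1 z.2 := by
  rw [continuous_iff_continuousAt]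
  rintro ⟨ξ, s⟩
  have h1 := continuousAt_optDepth hΩ hμ (x := x) (ξ := ξ) s ⟨0, by simpa using hx⟩
  have h2 : Continuous fun z : S d × ℝ => ((x, z.1), z.2) := by fun_prop
  exact ContinuousAt.comp_of_eq (f := fun z : S d × ℝ => ((x, z.1), z.2)) h1 h2.continuousAt rfl

theorem measurable_emission_uncurry (hΩ : IsAdmissibleDomain Ω Ωs)
    (hμ : IsAdmissibleMedium (⋃ j, Ωs j) μt μs p)
    (hG : Measurable fun q : E d × S d => G q.1 q.2) {x : E d} (hx : x ∈ Ω) :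
    Measurable fun z : S d × ℝ => emission μt G x z.1 z.2 := by
  refine Measurable.mul
    (Real.measurable_exp.comp (continuous_optDepth_uncurry hΩ hμ hx).measurable.neg) ?_
  exact hG.comp (f := fun z : S d × ℝ => (x - z.2 • (z.1 : E d), z.1)) (by fun_prop)

theorem IsAdmissibleMedium.continuous_phase {Ω₀ : Set (E d)}
    (hμ : IsAdmissibleMedium Ω₀ μt μs p) {x : E d} (hx : x ∈ Ω₀) (ξ : S d) :
    Continuous (p x ξ) :=
  hμ.p_continuousOn.comp_continuous (f := fun ξ' => (x, ξ, ξ')) (by fun_prop)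
    fun _ => ⟨hx, mem_univ _⟩

theorem emission_eq_zero (hG0 : ∀ x ∉ ⋃ j, Ωs j, ∀ ξ, G x ξ = 0)
    (hΩ : IsAdmissibleDomain Ω Ωs) {R : ℝ} (hR0 : 0 < R)
    (hR : ∀ x ∈ closure Ω, ∀ y ∈ closure Ω, dist x y < R) {x : E d} (hx : x ∈ closure Ω) (ξ : S d)
    {s : ℝ} (hs : R ≤ s) : emission μt G x ξ s = 0 := by
  have hD := hΩ.isConvexDomain
  have : x - s • (ξ : E d) ∉ Ω := sub_smul_not_mem hD (q := (x, ξ)) hx (hR0.trans_le hs)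
    ((tauMinus_le hD hR0 hR hx).trans hs)
  rw [emission, hG0 _ fun h => this (hΩ.iUnion_subset h), mul_zero]

/-- After the substitution y = x - sξ', the factor G is taken at the integration variable y and
depends on q only through the direction of x - y, in which it is continuous. The cutoff removes the
singularity at y = x and leaves a constant bound on the bounded set Ω₀. -/
theorem continuousAt_integral_cutoff (hΩ : IsAdmissibleDomain Ω Ωs)
    (hμ : IsAdmissibleMedium (⋃ j, Ωs j) μt μs p)
    (hG : Measurable fun q : E d × S d => G q.1 q.2) (hC : ∀ x ξ, |G x ξ| ≤ C)
    (hGd : ∀ x, Continuous (G x)) (hG0 : ∀ x ∉ ⋃ j, Ωs j, ∀ ξ, G x ξ = 0) {δ : ℝ} (hδ : 0 < δ)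
    {x₀ : E d} (hx₀ : x₀ ∈ ⋃ j, Ωs j) (ξ₀ : S d) :
    ContinuousAt (fun q : E d × S d => ∫ z : S d × ℝ,
      cutoff δ z.2 * (p q.1 q.2 z.1 * emission μt G q.1 z.1 z.2)
        ∂((sphereMeasure d).prod (volume.restrict (Ioi (0 : ℝ))))) (x₀, ξ₀) := by
  have hO := hΩ.isOpen_iUnion
  obtain ⟨Cp, hCp⟩ := hμ.p_bounded
  have hev : ∀ᶠ q : E d × S d in 𝓝 (x₀, ξ₀), q.1 ∈ ⋃ j, Ωs j :=
    continuousAt_fst.eventually (hO.mem_nhds hx₀)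
  have hC0 : 0 ≤ C := (abs_nonneg _).trans (hC x₀ ξ₀)
  have hCp0 : 0 ≤ Cp := (hμ.p_nonneg x₀ ξ₀ ξ₀).trans (hCp _ _ _)
  have hpolar : ∀ q : E d × S d, ∫ z : S d × ℝ,
      cutoff δ z.2 * (p q.1 q.2 z.1 * emission μt G q.1 z.1 z.2)
        ∂((sphereMeasure d).prod (volume.restrict (Ioi (0 : ℝ)))) =
      ∫ y : E d, (‖q.1 - y‖ ^ (d - 1))⁻¹ * (cutoff δ ‖q.1 - y‖ *
        (p q.1 q.2 (unitDir ξ₀ (q.1 - y)) *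
          (Real.exp (-optDepth μt q.1 (unitDir ξ₀ (q.1 - y)) ‖q.1 - y‖) *
            G y (unitDir ξ₀ (q.1 - y))))) := by
    intro q
    rw [integral_polar ξ₀
      fun ξ s => cutoff δ s * (p q.1 q.2 ξ * emission μt G q.1 ξ s),
      ← integral_sub_left_eq_self _ volume q.1]
    refine integral_congr_ae (Eventually.of_forall fun y => ?_)
    simp only [emission, norm_smul_unitDir, sub_sub_cancel]
  simp only [hpolar]
  refine continuousAt_of_dominated
    (bound := (⋃ j, Ωs j).indicator fun _ => (δ ^ (d - 1))⁻¹ * (1 * (Cp * (1 * C)))) ?_ ?_ ?_ ?_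
  · filter_upwards [hev] with q hq
    have hdir : Measurable fun y : E d => unitDir ξ₀ (q.1 - y) :=
      (measurable_unitDir ξ₀).comp (by fun_prop)
    have hn : Measurable fun y : E d => ‖q.1 - y‖ := by fun_prop
    refine Measurable.aestronglyMeasurable ?_
    refine (hn.pow_const _).inv.mul (((continuous_cutoff δ).measurable.comp hn).mul
      (((hμ.continuous_phase hq q.2).measurable.comp hdir).mul (Measurable.mul ?_ ?_)))
    · exact Real.measurable_exp.comp ((continuous_optDepth_uncurry hΩ hμ
        (hΩ.iUnion_subset hq)).measurable.comp (hdir.prodMk hn)).neg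
    · exact hG.comp (measurable_id.prodMk hdir)
  · filter_upwards [hev] with q hq
    refine Eventually.of_forall fun y => ?_
    by_cases hy : y ∈ ⋃ j, Ωs j
    · rw [indicator_of_mem hy]
      rcases le_or_gt ‖q.1 - y‖ δ with hle | hgt
      · rw [cutoff_eq_zero hδ hle, zero_mul, mul_zero, norm_zero]
        positivity
      · have e1 : |(‖q.1 - y‖ ^ (d - 1))⁻¹| ≤ (δ ^ (d - 1))⁻¹ := by
          rw [abs_of_nonneg (by positivity)]
          gcongr
        have e2 : |cutoff δ ‖q.1 - y‖| ≤ 1 := by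
          rw [abs_of_nonneg (cutoff_nonneg _ _)]
          exact cutoff_le_one _ _
        have e3 : |p q.1 q.2 (unitDir ξ₀ (q.1 - y))| ≤ Cp := by
          rw [abs_of_nonneg (hμ.p_nonneg _ _ _)]
          exact hCp _ _ _
        have e4 : |Real.exp (-optDepth μt q.1 (unitDir ξ₀ (q.1 - y)) ‖q.1 - y‖)| ≤ 1 := by
          rw [abs_of_nonneg (Real.exp_nonneg _)]
          exact exp_optDepth_le_one hμ _ _ (norm_nonneg _)
        rw [Real.norm_eq_abs, abs_mul, abs_mul, abs_mul, abs_mul]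
        have e5 := hC y (unitDir ξ₀ (q.1 - y))
        gcongr
    · rw [indicator_of_notMem hy, hG0 y hy]
      simp
  · rw [integrable_indicator_iff hO.measurableSet]
    refine integrableOn_const ?_
    exact ((hΩ.bounded.subset hΩ.iUnion_subset).measure_lt_top).ne
  · refine Eventually.of_forall fun y => ?_
    have hsub : Continuous fun q : E d × S d => q.1 - y := by fun_prop
    by_cases hyx : y = x₀
    · refine (continuousAt_const (y := (0 : ℝ))).congr ?_
      have : ∀ᶠ q : E d × S d in 𝓝 (x₀, ξ₀), ‖q.1 - y‖ < δ :=
        hsub.norm.continuousAt.eventually (Iio_mem_nhds (by simpa [hyx] using hδ))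
      filter_upwards [this] with q hq
      rw [cutoff_eq_zero hδ hq.le]
      simp
    by_cases hy : y ∈ ⋃ j, Ωs j
    · have hne : x₀ - y ≠ 0 := sub_ne_zero.2 fun h => hyx h.symm
      have hdir : ContinuousAt (fun q : E d × S d => unitDir ξ₀ (q.1 - y)) (x₀, ξ₀) :=
        ContinuousAt.comp_of_eq (f := fun q : E d × S d => q.1 - y)
          (continuousAt_unitDir ξ₀ hne) hsub.continuousAt rfl
      have hn : ContinuousAt (fun q : E d × S d => ‖q.1 - y‖) (x₀, ξ₀) := hsub.norm.continuousAt
      refine ((hn.pow _).inv₀ (pow_ne_zero _ (norm_ne_zero_iff.2 hne))).mul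
        (((continuous_cutoff δ).continuousAt.comp hn).mul (ContinuousAt.mul ?_
          (ContinuousAt.mul ?_ ((hGd y).continuousAt.comp hdir))))
      · have h1 : ContinuousAt (fun z : E d × S d × S d => p z.1 z.2.1 z.2.2)
            (x₀, ξ₀, unitDir ξ₀ (x₀ - y)) :=
          hμ.p_continuousOn.continuousAt ((hO.prod isOpen_univ).mem_nhds ⟨hx₀, mem_univ _⟩)
        exact ContinuousAt.comp_of_eq
          (f := fun q : E d × S d => (q.1, q.2, unitDir ξ₀ (q.1 - y))) h1
          (continuousAt_fst.prodMk (continuousAt_snd.prodMk hdir)) rfl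
      · have h1 := continuousAt_optDepth hΩ hμ (x := x₀) (ξ := unitDir ξ₀ (x₀ - y)) ‖x₀ - y‖
          ⟨0, by simpa using hΩ.iUnion_subset hx₀⟩
        exact Real.continuous_exp.continuousAt.comp (ContinuousAt.comp_of_eq
          (f := fun q : E d × S d => ((q.1, unitDir ξ₀ (q.1 - y)), ‖q.1 - y‖)) h1
          ((continuousAt_fst.prodMk hdir).prodMk hn) rfl).neg
    · simp only [hG0 y hy, mul_zero]
      exact continuousAt_const

/-- In the variables (ξ', s) the integrand is bounded, so discarding s < 2δ costs O(δ) uniformly in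
q: the integral is a uniform limit of the cutoff integrals. -/
theorem continuousAt_integral_collided (hΩ : IsAdmissibleDomain Ω Ωs)
    (hμ : IsAdmissibleMedium (⋃ j, Ωs j) μt μs p)
    (hG : Measurable fun q : E d × S d => G q.1 q.2) (hC : ∀ x ξ, |G x ξ| ≤ C)
    (hGd : ∀ x, Continuous (G x)) (hG0 : ∀ x ∉ ⋃ j, Ωs j, ∀ ξ, G x ξ = 0) {R : ℝ} (hR0 : 0 < R)
    (hR : ∀ x ∈ closure Ω, ∀ y ∈ closure Ω, dist x y < R)
    {x₀ : E d} (hx₀ : x₀ ∈ ⋃ j, Ωs j) (ξ₀ : S d) :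
    ContinuousAt (fun q : E d × S d =>
      ∫ ξ', p q.1 q.2 ξ' * collided μt G R q.1 ξ' ∂(sphereMeasure d)) (x₀, ξ₀) := by
  have hO := hΩ.isOpen_iUnion
  obtain ⟨Cp, hCp⟩ := hμ.p_bounded
  have hC0 : 0 ≤ C := (abs_nonneg _).trans (hC x₀ ξ₀)
  have hCp0 : 0 ≤ Cp := (hμ.p_nonneg x₀ ξ₀ ξ₀).trans (hCp _ _ _)
  -- The cutoff error is at most (M - 1)δ; the summand 1 makes it strictly less than ε = Mδ.
  set M : ℝ := Cp * C * ((sphereMeasure d).real univ * 2) + 1 with hM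
  have hM0 : 0 < M := by positivity
  refine continuousAt_of_locally_uniform_approx_of_continuousAt fun u hu => ?_
  obtain ⟨ε, hε, hεu⟩ := Metric.mem_uniformity_dist.1 hu
  set δ : ℝ := ε / M with hδdef
  have hδ : 0 < δ := by positivity
  refine ⟨{q | q.1 ∈ ⋃ j, Ωs j}, continuousAt_fst.eventually (hO.mem_nhds hx₀), _,
    continuousAt_integral_cutoff hΩ hμ hG hC hGd hG0 hδ hx₀ ξ₀, fun q hq => hεu ?_⟩
  have hq : q.1 ∈ ⋃ j, Ωs j := hq
  have hqΩ := hΩ.iUnion_subset hq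
  set m : Measure (S d × ℝ) := (sphereMeasure d).prod (volume.restrict (Ioc 0 R)) with hm
  have hmeas : Measurable fun z : S d × ℝ => p q.1 q.2 z.1 * emission μt G q.1 z.1 z.2 :=
    ((hμ.continuous_phase hq q.2).measurable.comp measurable_fst).mul
      (measurable_emission_uncurry hΩ hμ hG hqΩ)
  have hpos : ∀ᵐ z ∂m, 0 < z.2 ∧ z.2 ≤ R := by
    have h1 : ∀ᵐ s ∂(volume.restrict (Ioc 0 R)), 0 < s ∧ s ≤ R :=
      (ae_restrict_mem measurableSet_Ioc).mono fun s hs => hs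
    exact Measure.quasiMeasurePreserving_snd.ae h1
  have hbound : ∀ᵐ z ∂m, ‖p q.1 q.2 z.1 * emission μt G q.1 z.1 z.2‖ ≤ Cp * C := by
    filter_upwards [hpos] with z hz
    rw [norm_mul]
    have e1 : ‖p q.1 q.2 z.1‖ ≤ Cp := by
      rw [Real.norm_eq_abs, abs_of_nonneg (hμ.p_nonneg _ _ _)]
      exact hCp _ _ _
    exact mul_le_mul e1 (abs_emission_le hμ hC q.1 z.1 hz.1.le) (norm_nonneg _) hCp0
  have hint : Integrable (fun z : S d × ℝ => p q.1 q.2 z.1 * emission μt G q.1 z.1 z.2) m :=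
    Integrable.of_bound hmeas.aestronglyMeasurable _ hbound
  have hcm : Measurable fun z : S d × ℝ => cutoff δ z.2 :=
    (continuous_cutoff δ).measurable.comp measurable_snd
  have hint' : Integrable (fun z : S d × ℝ =>
      cutoff δ z.2 * (p q.1 q.2 z.1 * emission μt G q.1 z.1 z.2)) m := by
    refine Integrable.of_bound (hcm.mul hmeas).aestronglyMeasurable (1 * (Cp * C)) ?_
    filter_upwards [hbound] with z hz
    rw [norm_mul]
    refine mul_le_mul ?_ hz (norm_nonneg _) zero_le_one
    rw [Real.norm_eq_abs, abs_of_nonneg (cutoff_nonneg _ _)]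
    exact cutoff_le_one _ _
  have e1 : ∫ ξ', p q.1 q.2 ξ' * collided μt G R q.1 ξ' ∂(sphereMeasure d) =
      ∫ z, p q.1 q.2 z.1 * emission μt G q.1 z.1 z.2 ∂m := by
    rw [integral_prod _ hint]
    refine integral_congr_ae (Eventually.of_forall fun ξ' => ?_)
    simp only [collided]
    rw [intervalIntegral.integral_of_le hR0.le, integral_const_mul]
  have e2 : ∫ z, cutoff δ z.2 * (p q.1 q.2 z.1 * emission μt G q.1 z.1 z.2)
        ∂((sphereMeasure d).prod (volume.restrict (Ioi (0 : ℝ)))) =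
      ∫ z, cutoff δ z.2 * (p q.1 q.2 z.1 * emission μt G q.1 z.1 z.2) ∂m := by
    have hres : m = ((sphereMeasure d).prod (volume.restrict (Ioi (0 : ℝ)))).restrict
        (univ ×ˢ Iic R) := by
      rw [← Measure.prod_restrict, Measure.restrict_univ,
        Measure.restrict_restrict measurableSet_Iic, Set.inter_comm, Ioi_inter_Iic]
    rw [hres]
    refine (setIntegral_eq_integral_of_forall_compl_eq_zero fun z hz => ?_).symm
    have hzR : R < z.2 := by
      by_contra hle
      exact hz ⟨mem_univ _, not_lt.1 hle⟩
    rw [emission_eq_zero hG0 hΩ hR0 hR (subset_closure hqΩ) z.1 hzR.le, mul_zero, mul_zero]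
  rw [e1, e2, dist_eq_norm, ← integral_sub hint hint']
  have hset : MeasurableSet ((univ : Set (S d)) ×ˢ Iio (2 * δ)) :=
    MeasurableSet.univ.prod measurableSet_Iio
  have hle : ‖∫ z, (p q.1 q.2 z.1 * emission μt G q.1 z.1 z.2 -
      cutoff δ z.2 * (p q.1 q.2 z.1 * emission μt G q.1 z.1 z.2)) ∂m‖ ≤
      ∫ z, ((univ : Set (S d)) ×ˢ Iio (2 * δ)).indicator (fun _ => Cp * C) z ∂m := by
    refine norm_integral_le_of_norm_le ((integrable_const _).indicator hset) ?_
    filter_upwards [hbound] with z hz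
    by_cases h2 : z.2 < 2 * δ
    · rw [indicator_of_mem (show z ∈ (univ : Set (S d)) ×ˢ Iio (2 * δ) from ⟨mem_univ _, h2⟩),
        ← one_sub_mul, norm_mul]
      calc _ ≤ 1 * (Cp * C) := by
            refine mul_le_mul ?_ hz (norm_nonneg _) zero_le_one
            rw [Real.norm_eq_abs, abs_of_nonneg (by linarith [cutoff_le_one δ z.2])]
            linarith [cutoff_nonneg δ z.2]
        _ = _ := one_mul _
    · rw [cutoff_eq_one hδ (not_lt.1 h2), one_mul, sub_self, norm_zero]
      exact indicator_nonneg (fun _ _ => by positivity) _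
  refine hle.trans_lt ?_
  rw [integral_indicator_const _ hset, smul_eq_mul]
  have hreal : m.real ((univ : Set (S d)) ×ˢ Iio (2 * δ)) ≤
      (sphereMeasure d).real univ * (2 * δ) := by
    rw [hm, measureReal_prod_prod]
    gcongr
    rw [measureReal_restrict_apply measurableSet_Iio]
    calc (volume : Measure ℝ).real (Iio (2 * δ) ∩ Ioc 0 R)
        ≤ (volume : Measure ℝ).real (Ioo 0 (2 * δ)) :=
          measureReal_mono (fun s hs => ⟨hs.2.1, hs.1⟩) measure_Ioo_lt_top.ne
      _ = 2 * δ := by rw [Real.volume_real_Ioo_of_le (by positivity), sub_zero]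
  calc m.real ((univ : Set (S d)) ×ˢ Iio (2 * δ)) * (Cp * C)
      ≤ ((sphereMeasure d).real univ * (2 * δ)) * (Cp * C) := by gcongr
    _ = (M - 1) * δ := by rw [hM]; ring
    _ < M * δ := by gcongr; linarith
    _ = ε := by rw [hδdef]; field_simp

end Average

/-! ### Continuity of the scattering term -/

section StepData

open scoped ENNReal

variable {N : ℕ} {Ωs : Fin N → Set (E d)} {μt μs : E d → ℝ} {p : E d → S d → S d → ℝ}
  {f : E d × S d → ℝ} {A γ : Set (E d)} {I : ℝ}

theorem continuousAt_exp_optDepth (hΩ : IsAdmissibleDomain Ω Ωs)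
    (hμ : IsAdmissibleMedium (⋃ j, Ωs j) μt μs p) {q : E d × S d} (s : ℝ)
    (hq : ∃ t : ℝ, q.1 + t • (q.2 : E d) ∈ Ω) :
    ContinuousAt (fun q : E d × S d => Real.exp (-optDepth μt q.1 q.2 s)) q := by
  have h1 := continuousAt_optDepth hΩ hμ s hq
  have h2 : ContinuousAt (fun q : E d × S d => (q, s)) q := by fun_prop
  exact Real.continuous_exp.continuousAt.comp
    (ContinuousAt.comp (f := fun q : E d × S d => (q, s)) h1 h2).neg

/-- The indicator is first frozen at x₀, where the remaining factors converge pointwise; the error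
of freezing tends to 0 in L¹ against a bounded weight. -/
theorem continuousAt_integral_ballistic (hΩ : IsAdmissibleDomain Ω Ωs)
    (hμ : IsAdmissibleMedium (⋃ j, Ωs j) μt μs p) {K : Set (E d)} (hK : MeasurableSet K)
    {R : ℝ} (hR0 : 0 < R) {x₀ : E d} (hx₀ : x₀ ∈ ⋃ j, Ωs j) (ξ₀ : S d) :
    ContinuousAt (fun q : E d × S d => ∫ ξ', p q.1 q.2 ξ' *
      (K.indicator (fun _ => (1 : ℝ)) (exitPoint Ω (q.1, ξ')) *
        Real.exp (-optDepth μt q.1 ξ' R)) ∂(sphereMeasure d)) (x₀, ξ₀) := by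
  have hO := hΩ.isOpen_iUnion
  have hD := hΩ.isConvexDomain
  obtain ⟨Cp, hCp⟩ := hμ.p_bounded
  set k : E d → ℝ := K.indicator fun _ => (1 : ℝ) with hk
  have hkm : Measurable k := measurable_const.indicator hK
  have hk1 : ∀ y, |k y| ≤ 1 := fun y => by
    by_cases hy : y ∈ K <;> simp [hk, hy]
  have hev : ∀ᶠ q : E d × S d in 𝓝 (x₀, ξ₀), q.1 ∈ ⋃ j, Ωs j :=
    continuousAt_fst.eventually (hO.mem_nhds hx₀)
  have hΩx₀ := hΩ.iUnion_subset hx₀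
  set a : E d × S d → S d → ℝ := fun q ξ' => p q.1 q.2 ξ' * Real.exp (-optDepth μt q.1 ξ' R) with ha
  have hab : ∀ q ξ', |a q ξ'| ≤ Cp := fun q ξ' => by
    rw [ha, abs_mul, abs_of_nonneg (hμ.p_nonneg _ _ _), abs_of_nonneg (Real.exp_nonneg _)]
    calc _ ≤ p q.1 q.2 ξ' * 1 :=
          mul_le_mul_of_nonneg_left (exp_optDepth_le_one hμ _ _ hR0.le) (hμ.p_nonneg _ _ _)
      _ ≤ Cp := by rw [mul_one]; exact hCp _ _ _
  have ham : ∀ q : E d × S d, q.1 ∈ ⋃ j, Ωs j → Measurable (a q) := fun q hq => by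
    refine (hμ.continuous_phase hq q.2).measurable.mul
      (Real.measurable_exp.comp (Measurable.neg ?_))
    exact (continuous_optDepth_uncurry hΩ hμ (hΩ.iUnion_subset hq)).measurable.comp
      (f := fun ξ' : S d => (ξ', R)) (by fun_prop)
  have hac : ∀ ξ', ContinuousAt (fun q => a q ξ') (x₀, ξ₀) := fun ξ' => by
    refine ContinuousAt.mul ?_ ?_
    · have h1 : ContinuousAt (fun z : E d × S d × S d => p z.1 z.2.1 z.2.2) (x₀, ξ₀, ξ') :=
        hμ.p_continuousOn.continuousAt ((hO.prod isOpen_univ).mem_nhds ⟨hx₀, mem_univ _⟩)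
      exact ContinuousAt.comp_of_eq (f := fun q : E d × S d => (q.1, q.2, ξ')) h1
        (by fun_prop) rfl
    · exact ContinuousAt.comp_of_eq (f := fun q : E d × S d => (q.1, ξ'))
        (continuousAt_exp_optDepth hΩ hμ (q := (x₀, ξ')) R ⟨0, by simpa using hΩx₀⟩)
        (by fun_prop) rfl
  have hPm : ∀ x ∈ ⋃ j, Ωs j, Measurable fun ξ' => k (exitPoint Ω (x, ξ')) := fun x hx =>
    hkm.comp (continuous_exitPoint_dir hD (hΩ.iUnion_subset hx)).measurable
  have hint : ∀ q : E d × S d, q.1 ∈ ⋃ j, Ωs j → ∀ x ∈ ⋃ j, Ωs j,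
      Integrable (fun ξ' => a q ξ' * k (exitPoint Ω (x, ξ'))) (sphereMeasure d) := by
    intro q hq x hx
    refine Integrable.of_bound ((ham q hq).mul (hPm x hx)).aestronglyMeasurable (Cp * 1)
      (Eventually.of_forall fun ξ' => ?_)
    rw [norm_mul]
    exact mul_le_mul (hab _ _) (hk1 _) (norm_nonneg _) ((abs_nonneg _).trans (hab q ξ'))
  have hT1 : ContinuousAt (fun q => ∫ ξ', a q ξ' * k (exitPoint Ω (x₀, ξ')) ∂(sphereMeasure d))
      (x₀, ξ₀) := by
    refine continuousAt_of_dominated (bound := fun _ => Cp * 1) ?_ ?_ (integrable_const _) ?_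
    · filter_upwards [hev] with q hq
      exact ((ham q hq).mul (hPm x₀ hx₀)).aestronglyMeasurable
    · refine Eventually.of_forall fun q => Eventually.of_forall fun ξ' => ?_
      rw [norm_mul]
      exact mul_le_mul (hab _ _) (hk1 _) (norm_nonneg _) ((abs_nonneg _).trans (hab q ξ'))
    · exact Eventually.of_forall fun ξ' => (hac ξ').mul continuousAt_const
  have hT2 : Tendsto (fun q : E d × S d => ∫ ξ', a q ξ' * (k (exitPoint Ω (q.1, ξ')) -
      k (exitPoint Ω (x₀, ξ'))) ∂(sphereMeasure d)) (𝓝 (x₀, ξ₀)) (𝓝 0) := by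
    rw [tendsto_zero_iff_enorm_tendsto_zero]
    have hlim : Tendsto (fun q : E d × S d => ENNReal.ofReal Cp *
        ∫⁻ ξ' : S d, ‖k (exitPoint Ω (q.1, ξ')) - k (exitPoint Ω (x₀, ξ'))‖ₑ ∂(sphereMeasure d))
        (𝓝 (x₀, ξ₀)) (𝓝 0) := by
      have h1 : Tendsto (fun q : E d × S d => q.1) (𝓝 (x₀, ξ₀)) (𝓝 x₀) := continuousAt_fst
      have h2 := ENNReal.Tendsto.const_mul (a := ENNReal.ofReal Cp)
        ((tendsto_lintegral_indicator_exitPoint hD hΩx₀ hK).comp h1)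
        (Or.inr ENNReal.ofReal_ne_top)
      simpa [Function.comp_def] using h2
    refine tendsto_of_tendsto_of_tendsto_of_le_of_le tendsto_const_nhds hlim (fun _ => zero_le)
      fun q => ?_
    refine (enorm_integral_le_lintegral_enorm _).trans ?_
    rw [← lintegral_const_mul' _ _ ENNReal.ofReal_ne_top]
    refine lintegral_mono fun ξ' => ?_
    simp only
    rw [enorm_mul]
    gcongr
    rw [← ofReal_norm]
    exact ENNReal.ofReal_le_ofReal (hab _ _)
  have hsum : ContinuousAt (fun q : E d × S d =>
      (∫ ξ', a q ξ' * k (exitPoint Ω (x₀, ξ')) ∂(sphereMeasure d)) +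
      ∫ ξ', a q ξ' * (k (exitPoint Ω (q.1, ξ')) - k (exitPoint Ω (x₀, ξ'))) ∂(sphereMeasure d))
      (x₀, ξ₀) := by
    refine hT1.add ?_
    have h0 : ∫ ξ', a (x₀, ξ₀) ξ' * (k (exitPoint Ω (x₀, ξ')) - k (exitPoint Ω (x₀, ξ')))
        ∂(sphereMeasure d) = 0 := by simp
    rw [ContinuousAt, h0]
    exact hT2
  refine hsum.congr ?_
  filter_upwards [hev] with q hq
  have h1 : ∀ ξ', a q ξ' * (k (exitPoint Ω (q.1, ξ')) - k (exitPoint Ω (x₀, ξ'))) =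
      a q ξ' * k (exitPoint Ω (q.1, ξ')) - a q ξ' * k (exitPoint Ω (x₀, ξ')) :=
    fun ξ' => mul_sub _ _ _
  simp only [h1]
  rw [integral_sub (hint q hq _ hq) (hint q hq _ hx₀), add_sub_cancel]
  refine integral_congr_ae (Eventually.of_forall fun ξ' => ?_)
  simp only [ha]
  ring

theorem stepData_eq (q : E d × S d) :
    stepData A γ I q = I * (A ∪ γ).indicator (fun _ => (1 : ℝ)) q.1 := by
  by_cases h : q.1 ∈ A ∪ γ <;> simp [stepData, h]

theorem continuousOn_scatter (hΩ : IsAdmissibleDomain Ω Ωs)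
    (hμ : IsAdmissibleMedium (⋃ j, Ωs j) μt μs p)
    (hf : IsSolution Ω (⋃ j, Ωs j) μt μs p (stepData A γ I) f) (hK : MeasurableSet (A ∪ γ)) :
    ContinuousOn (fun q : E d × S d => scatter μs p f q.1 q.2) ((⋃ j, Ωs j) ×ˢ univ) := by
  have hO := hΩ.isOpen_iUnion
  have hD := hΩ.isConvexDomain
  obtain ⟨R, hR0, hR⟩ := exists_diam_bound hΩ.bounded
  obtain ⟨C, -, hC⟩ := exists_scatter_bound hμ hΩ.iUnion_subset hf
  obtain ⟨Cp, hCp⟩ := hμ.p_bounded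
  have hG := measurable_uncurry_scatter hμ hO (hΩ.bounded.subset hΩ.iUnion_subset)
    hΩ.iUnion_subset hf
  rintro ⟨x₀, ξ₀⟩ ⟨hx₀, -⟩
  refine ContinuousAt.continuousWithinAt ?_
  have hms : ContinuousAt (fun q : E d × S d => μs q.1) (x₀, ξ₀) :=
    ContinuousAt.comp_of_eq (f := Prod.fst)
      (hμ.mus_continuousOn.continuousAt (hO.mem_nhds hx₀)) continuousAt_fst rfl
  have h1 := continuousAt_integral_ballistic hΩ hμ hK hR0 hx₀ ξ₀
  have h2 := continuousAt_integral_collided hΩ hμ hG hC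
    (continuous_scatter_dir hμ hΩ.iUnion_subset hf) (fun x hx ξ => scatter_eq_zero hμ hx ξ)
    hR0 hR hx₀ ξ₀
  refine (hms.mul ((h1.const_mul I).add h2)).congr ?_
  filter_upwards [continuousAt_fst.eventually (hO.mem_nhds hx₀)] with q hq
  have hqΩ := hΩ.iUnion_subset hq
  have hdec : ∀ ξ', p q.1 q.2 ξ' * f (q.1, ξ') = I * (p q.1 q.2 ξ' *
      ((A ∪ γ).indicator (fun _ => (1 : ℝ)) (exitPoint Ω (q.1, ξ')) *
        Real.exp (-optDepth μt q.1 ξ' R))) +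
      p q.1 q.2 ξ' * collided μt (scatter μs p f) R q.1 ξ' := fun ξ' => by
    rw [eq_ballistic_add_collided hΩ hμ hf hR0 hR (q := (q.1, ξ')) (Or.inl hqΩ), stepData_eq]
    ring
  have hi1 : Integrable (fun ξ' => I * (p q.1 q.2 ξ' *
      ((A ∪ γ).indicator (fun _ => (1 : ℝ)) (exitPoint Ω (q.1, ξ')) *
        Real.exp (-optDepth μt q.1 ξ' R)))) (sphereMeasure d) := by
    refine Integrable.const_mul (Integrable.of_bound (Measurable.aestronglyMeasurable ?_)
      (Cp * (1 * 1)) (Eventually.of_forall fun ξ' => ?_)) _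
    · refine (hμ.continuous_phase hq q.2).measurable.mul (Measurable.mul ?_ ?_)
      · exact (measurable_const.indicator hK).comp (continuous_exitPoint_dir hD hqΩ).measurable
      · refine Real.measurable_exp.comp (Measurable.neg ?_)
        exact (continuous_optDepth_uncurry hΩ hμ hqΩ).measurable.comp
          (f := fun ξ' : S d => (ξ', R)) (by fun_prop)
    · have e1 : |p q.1 q.2 ξ'| ≤ Cp := by
        rw [abs_of_nonneg (hμ.p_nonneg _ _ _)]
        exact hCp _ _ _
      have e2 : |(A ∪ γ).indicator (fun _ => (1 : ℝ)) (exitPoint Ω (q.1, ξ'))| ≤ 1 := by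
        by_cases hy : exitPoint Ω (q.1, ξ') ∈ A ∪ γ <;> simp [hy]
      have e3 : |Real.exp (-optDepth μt q.1 ξ' R)| ≤ 1 := by
        rw [abs_of_nonneg (Real.exp_nonneg _)]
        exact exp_optDepth_le_one hμ _ _ hR0.le
      rw [Real.norm_eq_abs, abs_mul, abs_mul]
      have : 0 ≤ Cp := (abs_nonneg _).trans e1
      gcongr
  -- Obtained by difference, since p f is integrable by the definition of a solution.
  have hi2 : Integrable (fun ξ' => p q.1 q.2 ξ' * collided μt (scatter μs p f) R q.1 ξ')
      (sphereMeasure d) := by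
    refine ((hf.scattering_integrable q.1 hq q.2).sub hi1).congr
      (Eventually.of_forall fun ξ' => ?_)
    simp only [Pi.sub_apply]
    rw [hdec ξ']
    ring
  rw [scatter]
  simp only [hdec]
  rw [integral_add hi1 hi2, integral_const_mul]
  rfl

/-! ### The extension to the outgoing boundary -/

/-- The decomposition of the extended solution into its uncollided and collided parts. -/
theorem exists_extension_decomposition (hΩ : IsAdmissibleDomain Ω Ωs)
    (hμ : IsAdmissibleMedium (⋃ j, Ωs j) μt μs p)
    (hf : IsSolution Ω (⋃ j, Ωs j) μt μs p (stepData A γ I) f) (hK : MeasurableSet (A ∪ γ)) :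
    ∃ u v : E d × S d → ℝ, (∀ q ∈ phaseDbar Ω, ContinuousAt u q ∧ ContinuousAt v q) ∧
      (∀ q ∈ phaseDbar Ω, u q =
        Real.exp (-∫ r in (0 : ℝ)..tauMinus Ω q, μt (q.1 - r • (q.2 : E d)))) ∧
      (∀ q ∈ phaseDbar Ω, extension Ω f q =
        (A ∪ γ).indicator (fun _ => I) (exitPoint Ω q) * u q + v q) ∧
      ∀ q ∈ GammaPlus Ω, Tendsto (fun t : ℝ => f (q.1 - t • (q.2 : E d), q.2)) (𝓝[>] 0)
        (𝓝 (extension Ω f q)) := by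
  have hO := hΩ.isOpen_iUnion
  have hD := hΩ.isConvexDomain
  obtain ⟨R, hR0, hR⟩ := exists_diam_bound hΩ.bounded
  obtain ⟨C, -, hC⟩ := exists_scatter_bound hμ hΩ.iUnion_subset hf
  have hG := measurable_uncurry_scatter hμ hO (hΩ.bounded.subset hΩ.iUnion_subset)
    hΩ.iUnion_subset hf
  have hGc := continuousOn_scatter hΩ hμ hf hK
  set u : E d × S d → ℝ := fun q => Real.exp (-optDepth μt q.1 q.2 R) with hu
  set v : E d × S d → ℝ := fun q => collided μt (scatter μs p f) R q.1 q.2 with hv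
  have huc : ∀ q ∈ phaseDbar Ω, ContinuousAt u q := fun q hq =>
    continuousAt_exp_optDepth hΩ hμ R ((mem_phaseDbar_iff hD).1 hq).2
  have hvc : ∀ q ∈ phaseDbar Ω, ContinuousAt v q := fun q hq =>
    continuousAt_collided hΩ hμ hG hC hGc (fun x hx ξ => scatter_eq_zero hμ hx ξ) hR0.le
      ((mem_phaseDbar_iff hD).1 hq).2
  have hfD : ∀ q ∈ phaseD Ω, f q = (A ∪ γ).indicator (fun _ => I) (exitPoint Ω q) * u q + v q :=
    fun q hq => eq_ballistic_add_collided hΩ hμ hf hR0 hR hq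
  have hlim : ∀ q ∈ GammaPlus Ω, Tendsto (fun t : ℝ => f (q.1 - t • (q.2 : E d), q.2)) (𝓝[>] 0)
      (𝓝 ((A ∪ γ).indicator (fun _ => I) (exitPoint Ω q) * u q + v q)) := by
    intro q hq
    have hqb : q ∈ phaseDbar Ω := Or.inr hq
    have hcl := ((mem_phaseDbar_iff hD).1 hqb).1
    obtain ⟨-, t₀, ht₀, hmem⟩ := (mem_GammaPlus_iff hD).1 hq
    -- The indicator is frozen at the exit point of q, which is shared by all the points q - tξ in
    -- Ω.
    have hcont : ContinuousAt (fun q' => (A ∪ γ).indicator (fun _ => I) (exitPoint Ω q) * u q' +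
        v q') q := ((huc q hqb).const_mul _).add (hvc q hqb)
    have hline : Tendsto (fun t : ℝ => (q.1 - t • (q.2 : E d), q.2)) (𝓝[>] 0) (𝓝 q) := by
      have : Continuous fun t : ℝ => (q.1 - t • (q.2 : E d), q.2) := by fun_prop
      simpa using (this.tendsto 0).mono_left nhdsWithin_le_nhds
    refine (hcont.tendsto.comp hline).congr' ?_
    filter_upwards [self_mem_nhdsWithin, nhdsWithin_le_nhds (Iio_mem_nhds ht₀)] with t ht1 ht2
    have ht1 : 0 < t := ht1
    have ht2 : t < t₀ := ht2
    have htΩ : q.1 - t • (q.2 : E d) ∈ Ω :=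
      (mem_iff_lt_tauMinus hD hcl ht1).2 (ht2.trans ((mem_iff_lt_tauMinus hD hcl ht₀).1 hmem))
    have hin : (q.1 - t • (q.2 : E d), q.2) ∈ phaseD Ω := Or.inl htΩ
    have hexit : exitPoint Ω (q.1 - t • (q.2 : E d), q.2) = exitPoint Ω q := by
      have := exitPoint_add hD hqb (s := -t)
        (by rw [neg_smul, ← sub_eq_add_neg]; exact Or.inl hin)
      rwa [neg_smul, ← sub_eq_add_neg] at this
    rw [hfD _ hin, hexit]
    rfl
  have hext : ∀ q ∈ phaseDbar Ω, extension Ω f q =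
      (A ∪ γ).indicator (fun _ => I) (exitPoint Ω q) * u q + v q := by
    intro q hq
    rw [extension]
    split_ifs with h1 h2
    · exact hfD q h1
    · exact (hlim q h2).limUnder_eq
    · exact absurd hq (not_or.2 ⟨h1, h2⟩)
  refine ⟨u, v, fun q hq => ⟨huc q hq, hvc q hq⟩, fun q hq => ?_, hext, fun q hq => ?_⟩
  · have h1 : ∫ r in (0 : ℝ)..tauMinus Ω q, μt (q.1 - r • (q.2 : E d)) = optDepth μt q.1 q.2 R :=
      integral_tauMinus_eq hD hR0 hR ((mem_phaseDbar_iff hD).1 hq).1 fun s hs =>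
        hμ.mut_zero _ fun h => hs (hΩ.iUnion_subset h)
    rw [h1]
  · rw [hext q (Or.inr hq)]
    exact hlim q hq

end StepData

/-! ### Accumulation of the side sets -/

theorem exists_line_mem (hD : IsConvexDomain Ω) {q : E d × S d} (hq : q ∈ phaseDbar Ω)
    {U : Set (E d)} (hU : U ∈ 𝓝 q.1) :
    ∃ s : ℝ, s ≠ 0 ∧ q.1 + s • (q.2 : E d) ∈ U ∧ q.1 + s • (q.2 : E d) ∈ Ω := by
  have key : ∀ (w : E d) (t : ℝ), 0 < t → q.1 + t • w ∈ Ω →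
      ∃ s : ℝ, s ≠ 0 ∧ q.1 + s • w ∈ U ∧ q.1 + s • w ∈ Ω := by
    intro w t ht htΩ
    obtain ⟨s, ⟨hs1, hs2⟩, hs3⟩ := (((tendsto_line q.1 w).eventually hU).and
      (nhdsWithin_le_nhds (Iio_mem_nhds ht))).and self_mem_nhdsWithin |>.exists
    have hs3 : 0 < s := hs3
    have hs2 : s < t := hs2
    exact ⟨s, hs3.ne', hs1, hD.between (a := 0)
      (by simpa using ((mem_phaseDbar_iff hD).1 hq).1) htΩ hs3 hs2.le⟩
  obtain ⟨-, t, ht⟩ := (mem_phaseDbar_iff hD).1 hq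
  rcases lt_trichotomy t 0 with h0 | h0 | h0
  · obtain ⟨s, hs1, hs2, hs3⟩ := key (-(q.2 : E d)) (-t) (by linarith) (by simpa using ht)
    exact ⟨-s, neg_ne_zero.2 hs1, by simpa using hs2, by simpa using hs3⟩
  · subst h0
    obtain ⟨t', ht1, ht2⟩ := (((tendsto_line q.1 (q.2 : E d)).eventually
      (hD.isOpen.mem_nhds (by simpa using ht))).and self_mem_nhdsWithin).exists
    exact key _ t' ht2 ht1
  · exact key _ t h0 ht

/-- The pairs near q have varying directions, but their exit points y ∈ T come close to P(q) by
continuity of P. Starting at such y and travelling in the direction of q itself gives points of the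
section near q.1 that exit at y. -/
theorem accPt_sideSet (hD : IsConvexDomain Ω) {q : E d × S d} (hq : q ∈ phaseDbar Ω)
    {T : Set (E d)} (hT : ∃ᶠ q' in 𝓝[phaseDbar Ω] q, exitPoint Ω q' ∈ T) :
    AccPt q.1 (𝓟 (sideSet Ω q.2 T)) := by
  rw [accPt_iff_frequently, frequently_iff]
  intro U hU
  -- If P(q) ∈ T, other points on the line through q serve; otherwise the points constructed differ
  -- from q.1 because their exit point does.
  by_cases hP : exitPoint Ω q ∈ T
  · obtain ⟨s, hs0, hsU, hsΩ⟩ := exists_line_mem hD hq hU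
    have hmem : (q.1 + s • (q.2 : E d), q.2) ∈ phaseDbar Ω := Or.inl (Or.inl hsΩ)
    refine ⟨_, hsU, fun h => hs0 ?_, hmem, ?_⟩
    · have h1 : s • (q.2 : E d) = 0 := by simpa using h
      have h2 : (q.2 : E d) ≠ 0 := by
        rw [← norm_ne_zero_iff, norm_dir]
        exact one_ne_zero
      exact (smul_eq_zero.1 h1).resolve_right h2
    · rwa [exitPoint_add hD hq hmem]
  set τ := tauMinus Ω q with hτ
  have hτ0 : 0 ≤ τ := tauMinus_nonneg _
  have hback : exitPoint Ω q + τ • (q.2 : E d) = q.1 := by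
    rw [exitPoint]
    module
  have hfreq : ∃ᶠ y in 𝓝 (exitPoint Ω q), y ∈ frontier Ω ∧ y ∈ T := by
    have htend : Tendsto (exitPoint Ω) (𝓝[phaseDbar Ω] q) (𝓝 (exitPoint Ω q)) :=
      continuousOn_exitPoint hD q hq
    refine htend.frequently ((hT.and_eventually self_mem_nhdsWithin).mono fun q' hq' => ?_)
    exact ⟨exitPoint_mem_frontier hD ((mem_phaseDbar_iff hD).1 hq'.2).1, hq'.1⟩
  -- If τ = 0 the boundary points y themselves are used; if τ > 0, the points y + sξ with s slightly
  -- below τ, which lie in Ω.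
  rcases hτ0.eq_or_lt with h0 | h0
  · have hx : exitPoint Ω q = q.1 := by
      rw [← hback, ← h0, zero_smul, add_zero]
    obtain ⟨-, t, ht0, ht⟩ := (mem_GammaMinus_iff hD).1 (exitPoint_mem_GammaMinus hD hq)
    have hopen : ∀ᶠ y in 𝓝 (exitPoint Ω q), y + t • (q.2 : E d) ∈ Ω := by
      have : Continuous fun y : E d => y + t • (q.2 : E d) := by fun_prop
      exact this.continuousAt.eventually (hD.isOpen.mem_nhds ht)
    have hU' : ∀ᶠ y in 𝓝 (exitPoint Ω q), y ∈ U := by rwa [hx]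
    obtain ⟨y, ⟨hyf, hyT⟩, hyt, hyU⟩ := (hfreq.and_eventually (hopen.and hU')).exists
    have hyb : (y, q.2) ∈ phaseDbar Ω :=
      (mem_phaseDbar_iff hD).2 ⟨frontier_subset_closure hyf, t, hyt⟩
    refine ⟨y, hyU, fun h => hP (by rwa [hx, ← h]), hyb, ?_⟩
    have hyΩ : y ∉ Ω := by
      rw [hD.isOpen.frontier_eq] at hyf
      exact hyf.2
    have hy0 : tauMinus Ω (y, q.2) = 0 := by
      by_contra hne
      have hpos : 0 < tauMinus Ω (y, q.2) := lt_of_le_of_ne (tauMinus_nonneg _) (Ne.symm hne)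
      obtain ⟨s, hs0, hs1⟩ := exists_between hpos
      have hs := (mem_iff_lt_tauMinus hD (q := (y, q.2)) (frontier_subset_closure hyf) hs0).2 hs1
      refine hyΩ ?_
      have := hD.between (x := y) (v := (q.2 : E d)) (a := -s) (b := t) (c := 0)
        (by rw [neg_smul, ← sub_eq_add_neg]; exact subset_closure hs) hyt (by linarith) ht0.le
      simpa using this
    rw [exitPoint, hy0, zero_smul, sub_zero]
    exact hyT
  · have hcl := ((mem_phaseDbar_iff hD).1 hq).1
    have hcont : Continuous fun z : E d × ℝ => z.1 + z.2 • (q.2 : E d) := by fun_prop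
    have hU' : (fun z : E d × ℝ => z.1 + z.2 • (q.2 : E d)) ⁻¹' U ∈ 𝓝 (exitPoint Ω q, τ) :=
      hcont.continuousAt.preimage_mem_nhds (by simpa only [hback] using hU)
    rw [nhds_prod_eq] at hU'
    obtain ⟨V, hV, W, hW, hVW⟩ := mem_prod_iff.1 hU'
    have hW' : ∀ᶠ s in 𝓝[<] τ, s ∈ W := nhdsWithin_le_nhds hW
    obtain ⟨s, ⟨hsW, hs0⟩, hsτ⟩ :=
      ((hW'.and (nhdsWithin_le_nhds (Ioi_mem_nhds h0))).and self_mem_nhdsWithin).exists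
    have hs0 : 0 < s := hs0
    have hsτ : s < τ := hsτ
    have hsΩ : exitPoint Ω q + s • (q.2 : E d) ∈ Ω := by
      have := (mem_iff_lt_tauMinus hD hcl (t := τ - s) (by linarith)).2 (by linarith)
      convert this using 1
      rw [exitPoint]
      module
    have hopen : ∀ᶠ y in 𝓝 (exitPoint Ω q), y + s • (q.2 : E d) ∈ Ω := by
      have : Continuous fun y : E d => y + s • (q.2 : E d) := by fun_prop
      exact this.continuousAt.eventually (hD.isOpen.mem_nhds hsΩ)
    obtain ⟨y, ⟨hyf, hyT⟩, hyt, hyV⟩ := (hfreq.and_eventually (hopen.and hV)).exists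
    have hexit : exitPoint Ω (y + s • (q.2 : E d), q.2) = y :=
      exitPoint_eq_of_mem_frontier hD hyt hyf hs0 (by rw [add_sub_cancel_right])
    refine ⟨y + s • (q.2 : E d), hVW (show (y, s) ∈ V ×ˢ W from ⟨hyV, hsW⟩), fun h => hP ?_,
      Or.inl (Or.inl hyt), by rwa [hexit]⟩
    rw [h] at hexit
    rwa [← hexit] at hyT

/-! ### The dividing curve -/

theorem IsDividing.isClosed {γ : Set (E d)} (hγ : IsDividing Ω γ) : IsClosed γ := by
  rcases hγ.2 with ⟨-, h⟩ | ⟨-, c, hc, -, rfl⟩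
  · exact (Set.finite_of_ncard_ne_zero (by omega)).isClosed
  · exact (isCompact_range hc).isClosed

/-- A component is closed relative to the Borel set ∂Ω \ γ. -/
theorem SplitsInto.measurableSet {γ A B : Set (E d)} (h : SplitsInto Ω γ A B) (hγ : IsClosed γ) :
    MeasurableSet (A ∪ γ) := by
  obtain ⟨⟨a, ha, rfl⟩, -⟩ := h
  have hF : MeasurableSet (frontier Ω \ γ) := isClosed_frontier.measurableSet.diff hγ.measurableSet
  rw [connectedComponentIn_eq_image ha]
  exact (hF.subtype_image isClosed_connectedComponent.measurableSet).union hγ.measurableSet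

theorem SplitsInto.mem_B_iff {γ A B : Set (E d)} (h : SplitsInto Ω γ A B) {y : E d}
    (hy : y ∈ frontier Ω) : y ∈ B ↔ y ∉ A ∪ γ := by
  obtain ⟨-, -, hdisj, hunion⟩ := h
  constructor
  · rintro hB (hA | hγ)
    · exact disjoint_left.1 hdisj hA hB
    · have : y ∈ A ∪ B := Or.inr hB
      rw [hunion] at this
      exact this.2 hγ
  · intro hn
    have : y ∈ A ∪ B := by
      rw [hunion]
      exact ⟨hy, fun hc => hn (Or.inr hc)⟩
    exact this.resolve_left fun hc => hn (Or.inl hc)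

/-- The jump of a function is unique. -/
theorem HasJump.unique {A B γ : Set (E d)} {g : E d × S d → ℝ} {q : E d × S d} {J J' : ℝ}
    (h : HasJump Ω A B γ g q J) (h' : HasJump Ω A B γ g q J') : J = J' := by
  obtain ⟨h1, h2, a, b, ha, hb, rfl⟩ := h
  obtain ⟨-, -, a', b', ha', hb', rfl⟩ := h'
  have n1 : (𝓝[sideSet Ω q.2 (A ∪ γ)] q.1).NeBot := h1.clusterPt
  have n2 : (𝓝[sideSet Ω q.2 B] q.1).NeBot := h2.clusterPt
  rw [tendsto_nhds_unique ha ha', tendsto_nhds_unique hb hb']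

/-- From an outgoing boundary point the forward ray misses Ω: a point of Ω on it would, by
convexity, put q.1 itself into Ω. -/
theorem xRay_eq_of_mem_GammaPlus (hD : IsConvexDomain Ω) {μ : E d → ℝ} (hμ : ∀ x ∉ Ω, μ x = 0)
    {q : E d × S d} (hq : q ∈ GammaPlus Ω) :
    xRay μ q = ∫ r in (0 : ℝ)..tauMinus Ω q, μ (q.1 - r • (q.2 : E d)) := by
  obtain ⟨hfr, t, ht0, ht⟩ := (mem_GammaPlus_iff hD).1 hq
  have hqΩ : q.1 ∉ Ω := by
    rw [hD.isOpen.frontier_eq] at hfr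
    exact hfr.2
  rw [xRay, intervalIntegral.integral_of_le (tauMinus_nonneg _)]
  refine (setIntegral_eq_integral_of_forall_compl_eq_zero fun r hr => hμ _ fun hmem => ?_).symm
  rcases le_or_gt r 0 with h0 | h0
  · refine hqΩ ?_
    have := hD.between (x := q.1) (v := -(q.2 : E d)) (a := r) (b := t) (c := 0)
    rcases h0.eq_or_lt with h | h
    · subst h
      simpa using hmem
    · have := this (by rw [smul_neg, ← sub_eq_add_neg]; exact subset_closure hmem)
        (by rwa [smul_neg, ← sub_eq_add_neg]) h ht0.le
      simpa using this
  · exact hr ⟨h0, ((mem_iff_lt_tauMinus hD (frontier_subset_closure hfr) h0).1 hmem).le⟩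

end Transport

end

/-! ### The jump formula and the recovery of the X-ray transform. -/

theorem theorem3 (d : ℕ) (Ω : Set (Transport.E d)) (N : ℕ) (Ωs : Fin N → Set (Transport.E d))
    (hΩ : Transport.IsAdmissibleDomain Ω Ωs)
    (μt μs : Transport.E d → ℝ) (p : Transport.E d → Transport.S d → Transport.S d → ℝ)
    (hμ : Transport.IsAdmissibleMedium (⋃ j, Ωs j) μt μs p)
    (γ A B : Set (Transport.E d)) (hγ : Transport.IsDividing Ω γ)
    (hAB : Transport.SplitsInto Ω γ A B) (I : ℝ)
    (f : Transport.E d × Transport.S d → ℝ)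
    (hf : Transport.IsSolution Ω (⋃ j, Ωs j) μt μs p (Transport.stepData A γ I) f) :
    -- the limits that define the extension exist
    (∀ q ∈ Transport.GammaPlus Ω,
      Tendsto (fun t : ℝ => f (q.1 - t • (q.2 : Transport.E d), q.2)) (𝓝[>] 0)
        (𝓝 (Transport.extension Ω f q))) ∧
    ∀ q ∈ Transport.discSet Ω (Transport.extension Ω f),
      -- the decay formula for the jump
      Transport.HasJump Ω A B γ (Transport.extension Ω f) q
        (I * Real.exp (-∫ r in (0 : ℝ)..Transport.tauMinus Ω q,
          μt (q.1 - r • (q.2 : Transport.E d)))) ∧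
      -- the X-ray transform from a jump measured on the outgoing boundary
      (q ∈ Transport.GammaPlus Ω → ∀ J : ℝ,
        Transport.HasJump Ω A B γ (Transport.extension Ω f) q J →
          Transport.xRay μt q =
              ∫ r in (0 : ℝ)..Transport.tauMinus Ω q, μt (q.1 - r • (q.2 : Transport.E d)) ∧
          Transport.xRay μt q = -Real.log (J / I)) := by
  have hD := hΩ.isConvexDomain
  have hK : MeasurableSet (A ∪ γ) := hAB.measurableSet hγ.isClosed
  obtain ⟨u, v, hc, hu, hext, hlim⟩ :=
    Transport.exists_extension_decomposition hΩ hμ hf hK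
  refine ⟨hlim, fun q hq => ?_⟩
  obtain ⟨hqb, hdisc⟩ := hq
  set k : Transport.E d → ℝ := (A ∪ γ).indicator fun _ => I with hk
  -- As u and v are continuous, the discontinuity must come from the boundary data at the exit
  -- point. Hence both sides occur arbitrarily near q, and I ≠ 0.
  have hnot : ¬ ContinuousWithinAt (fun q => k (Transport.exitPoint Ω q))
      (Transport.phaseDbar Ω) q := fun h =>
    hdisc (((h.mul (hc q hqb).1.continuousWithinAt).add
      (hc q hqb).2.continuousWithinAt).congr (fun q' hq' => hext q' hq') (hext q hqb))
  have hfr : ∀ q' ∈ Transport.phaseDbar Ω, Transport.exitPoint Ω q' ∈ frontier Ω := fun q' hq' =>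
    Transport.exitPoint_mem_frontier hD ((Transport.mem_phaseDbar_iff hD).1 hq').1
  have hA : ∃ᶠ q' in 𝓝[Transport.phaseDbar Ω] q, Transport.exitPoint Ω q' ∈ A ∪ γ := by
    intro hev
    refine hnot ((continuousWithinAt_const (b := (0 : ℝ))).congr_of_eventuallyEq_of_mem ?_ hqb)
    filter_upwards [hev] with q' hq'
    exact indicator_of_notMem hq' _
  have hB : ∃ᶠ q' in 𝓝[Transport.phaseDbar Ω] q, Transport.exitPoint Ω q' ∈ B := by
    intro hev
    refine hnot ((continuousWithinAt_const (b := I)).congr_of_eventuallyEq_of_mem ?_ hqb)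
    filter_upwards [hev, self_mem_nhdsWithin] with q' hq' hq'b
    refine indicator_of_mem ?_ _
    by_contra hn
    exact hq' ((hAB.mem_B_iff (hfr q' hq'b)).2 hn)
  have hI : I ≠ 0 := by
    rintro rfl
    refine hnot ?_
    have : (fun q => k (Transport.exitPoint Ω q)) = fun _ => (0 : ℝ) := by
      funext q'
      simp [hk]
    rw [this]
    exact continuousWithinAt_const
  -- On one side the data are a constant c, so the extension agrees there with the continuous
  -- function c u + v.
  have hside : ∀ (T : Set (Transport.E d)) (c : ℝ),
      (∀ q' ∈ Transport.phaseDbar Ω, Transport.exitPoint Ω q' ∈ T →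
        k (Transport.exitPoint Ω q') = c) →
      Tendsto (fun x => Transport.extension Ω f (x, q.2)) (𝓝[Transport.sideSet Ω q.2 T] q.1)
        (𝓝 (c * u q + v q)) := by
    intro T c hT
    have hcont : ContinuousAt (fun q' => c * u q' + v q') q :=
      ((hc q hqb).1.const_mul c).add (hc q hqb).2
    have hsec : Tendsto (fun x : Transport.E d => (x, q.2))
        (𝓝[Transport.sideSet Ω q.2 T] q.1) (𝓝 q) := by
      have : Continuous fun x : Transport.E d => (x, q.2) := by fun_prop
      exact (this.tendsto q.1).mono_left nhdsWithin_le_nhds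
    refine (hcont.tendsto.comp hsec).congr' ?_
    filter_upwards [self_mem_nhdsWithin] with x hx
    rw [hext _ hx.1, hT _ hx.1 hx.2]
    rfl
  have hjump : Transport.HasJump Ω A B γ (Transport.extension Ω f) q
      (I * Real.exp (-∫ r in (0 : ℝ)..Transport.tauMinus Ω q,
        μt (q.1 - r • (q.2 : Transport.E d)))) := by
    refine ⟨Transport.accPt_sideSet hD hqb hA, Transport.accPt_sideSet hD hqb hB,
      I * u q + v q, 0 * u q + v q, hside _ _ fun q' _ hq' => indicator_of_mem hq' _,
      hside _ _ fun q' hq'b hq' =>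
        indicator_of_notMem ((hAB.mem_B_iff (hfr q' hq'b)).1 hq') _, ?_⟩
    rw [← hu q hqb]
    ring
  refine ⟨hjump, fun hqp J hJ => ?_⟩
  have hx := Transport.xRay_eq_of_mem_GammaPlus hD
    (fun x hx => hμ.mut_zero x fun h => hx (hΩ.iUnion_subset h)) hqp
  refine ⟨hx, ?_⟩
  rw [hJ.unique hjump, mul_div_cancel_left₀ _ hI, Real.log_exp, neg_neg]
  exact hx
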